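/- Let $\mathcal C_0=[0,1]$ and $\mathcal C_{n+1}=\tfrac14\mathcal C_n\cup\left(\tfrac34+\tfrac14\mathcal C_n\right)$, so that $\mathcal C_n$ is the $n$-th generation of the middle-half Cantor set, and let $\mathcal K_n=\mathcal C_n\times\mathcal C_n\subset\mathbb R^2=\mathbb C$ be the $n$-th generation of the four-corner Cantor set (a union of $4^n$ squares of side $4^{-n}$). For $r>0$ put $f_r(y)=r-\sqrt{r^2-y^2}$ for $|y|\le 2$ and $f_r(y)=r-\sqrt{r^2-4}$ for $|y|>2$ (for $r<2$ read the square root of a negative number as $0$; then only values $|y|\le\sqrt2<r$ matter below when $r\ge 4^{2/5}$). Let $\sigma_0(x,y)=(x-f_r(y),y)$ and $\sigma_\theta=R_{-\theta}\circ\sigma_0\circ R_\theta$, where $R_\theta$ is the clockwise rotation by the angle $\theta$, and define the distorted Favard length $$\mathrm{Fav}_{\sigma^{f_r}}(E)=\frac1{2\pi}\int_0^{2\pi}\left|\mathrm{Proj}_\theta(\sigma_\theta(E))\right|\,d\theta ,$$ where $\mathrm{Proj}_\theta$ is the orthogonal projection onto the line in direction $e^{i\theta}$ and $|\cdot|$ is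 Lebesgue measure on that line. Theorem. There is an absolute constant $C>0$ such that for every sequence of radii $(r_n)_{n\ge1}$ with $r_n\ge 4^{n/5}$ for all $n\ge1$, and for every $n\ge1$: 1. $\displaystyle \mathrm{Fav}_{\sigma^{f_{r_n}}}(\mathcal K_n)\ \ge\ C\,\frac{\log n}{n}$, that is, the sequence $(r_n)$ is undercooked; 2. the set of centers $z\in\mathbb C$ of those circles $\{w:|w-z|=r_n\}$ that meet $\mathcal K_n$ has area at least $\displaystyle C\, r_n\,\frac{\log n}{n}$. -/

import Mathlib

open MeasureTheory Set
open scoped ENNReal ComplexConjugate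

noncomputable section

namespace BuffonNoodle

/-- The `n`-th generation `𝒞ₙ ⊆ [0, 1]` of the middle-half Cantor set: a union of `2 ^ n` closed
intervals of length `4 ^ (-n)`. -/
def cantor : ℕ → Set ℝ
  | 0 => Icc 0 1
  | n + 1 => (fun x : ℝ => x / 4) '' cantor n ∪ (fun x : ℝ => (x + 3) / 4) '' cantor n

/-- The `n`-th generation `𝒦ₙ = 𝒞ₙ × 𝒞ₙ` of the four-corner Cantor set: a union of `4 ^ n` closed
squares of side length `4 ^ (-n)`. -/
def fourCorner (n : ℕ) : Set ℂ := {z | z.re ∈ cantor n ∧ z.im ∈ cantor n}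

/-- For `u = e ^ (iθ)`, the clockwise rotation `R_θ` of the plane by the angle `θ`. -/
def rot (u : Circle) (z : ℂ) : ℂ := conj (u : ℂ) * z

/-- For `u = e ^ (iθ)`, the orthogonal projection `Proj_θ` onto the oriented line `ℝ e ^ (iθ)`,
this line being identified with `ℝ`. -/
def proj (u : Circle) (z : ℂ) : ℝ := (rot u z).re

/-- The distorted Favard length
`Fav_T(E) = (1 / 2π) ∫_0^{2π} |Proj_θ(T_θ(E))| dθ`, where `T_θ(z) = T(z, e ^ (iθ))` and `|·|` is
Lebesgue measure on the line. -/
def favardLength (T : ℂ × Circle → ℂ) (E : Set ℂ) : ℝ≥0∞ :=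
  (ENNReal.ofReal (2 * Real.pi))⁻¹ *
    ∫⁻ θ in Ioc (0 : ℝ) (2 * Real.pi),
      volume (proj (Circle.exp θ) '' ((fun z : ℂ => T (z, Circle.exp θ)) '' E))

/-- The horizontal shear `σ₀ᵍ(x, y) = (x - g(y), y)`. -/
def shear (g : ℝ → ℝ) (z : ℂ) : ℂ := ⟨z.re - g z.im, z.im⟩

/-- The map `σᵍ : ℂ × S¹ → ℂ` given by `σ_θᵍ = R_{-θ} ∘ σ₀ᵍ ∘ R_θ`. -/
def sigma (g : ℝ → ℝ) (p : ℂ × Circle) : ℂ := rot p.2⁻¹ (shear g (rot p.2 p.1))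

/-- The circular-arc noodle: `f_r(y) = r - √(r² - y²)` for `|y| ≤ 2`, extended by the constant
`r - √(r² - 4)`. -/
def arc (r y : ℝ) : ℝ :=
  if |y| ≤ 2 then r - √(r ^ 2 - y ^ 2) else r - √(r ^ 2 - 4)

/-- `T₁, T₂, …` is an undercooking of the plane with constant `C`:
`Fav_{Tₙ}(𝒦ₙ) ≥ C log n / n` for all `n ≥ 1`. -/
def IsUndercooking (C : ℝ) (T : ℕ → ℂ × Circle → ℂ) : Prop :=
  ∀ n : ℕ, 1 ≤ n →
    ENNReal.ofReal (C * (Real.log n / n)) ≤ favardLength (T n) (fourCorner n)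

/-- The sequence of radii `r₁, r₂, …` is undercooked with constant `C`: the maps induced by the
circular-arc noodles of radius `rₙ` form an undercooking of the plane. -/
def IsUndercooked (C : ℝ) (r : ℕ → ℝ) : Prop :=
  IsUndercooking C fun n => sigma (arc (r n))

/-- The set of centers of the circles of radius `r` that meet `𝒦ₙ`. -/
def centers (n : ℕ) (r : ℝ) : Set ℂ := {z | (Metric.sphere z r ∩ fourCorner n).Nonempty}

end BuffonNoodle

end

/-!
The argument is the second moment method of Bateman and Volberg. The squares of `𝒦ₙ` are numbered
by `a < 4 ^ n` so that the lower left corner of the square number `a` is `3 · 4⁻ⁿ (x, y)` with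
`2x + y = a`; in the direction `arctan (1 / 2)` the corners therefore project to equally spaced
points. In the direction `arctan (1 / 2) + s`, the image of each square under the noodle shear
contains an interval of length `4⁻ⁿ` starting at the image of its corner. With `F` counting these
intervals, `1_{F > 0} ≥ 2λF - λ²F²` (`volume_iUnion_Icc_ge`), so the union of the intervals (the
`shadow`) is large once few pairs of intervals overlap.

The directions are split into the ranges `4^{-j-1} < s ≤ 4^{-j}`. Suppose that the numbers `a`, `b`
lie in different blocks of length `4 ^ l`, but in a common block of length `4 ^ (l + 1)`. Then the
squares are at distance about `4^{l-n}`, and an overlap in the `j`-th range forces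
`|a - b| ≲ 4 ^ (l - j)` (`principal_sub_le_of_overlap`). Both numbers are then within that distance
of the same multiple of `4 ^ l`, so there are only `≲ 4 ^ (n + l) 16⁻ʲ` such pairs
(`card_close_separated_le`), and each overlaps for a set of angles of length `≲ 4⁻ˡ`
(`angle_sub_le_of_overlap`). The bending of the noodle perturbs these estimates by a relative
`O(1 / r)`, which is harmless as `r` is large compared with `4 ^ j ≤ n`. Summing over `l`, the
second moment over the `j`-th range is `≲ n 16⁻ʲ`, so this range contributes
`≳ (4⁻ʲ)² / (n 16⁻ʲ) = 1 / n` to the integral of the length of the shadow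
(`lintegral_shadow_dyadic_ge`). There are about `log n` ranges with `4 ^ j ≤ n`, which gives
`log n / n`; bounded values of `n` are covered by a single interval of the shadow.

The two conclusions follow: the shadows lie in the projections which define the Favard length, and
the points with polar coordinates `(r + t, θ)`, for `t` in the shadow in the direction `θ`, are
centers of circles of radius `r` which meet `𝒦ₙ`, and `r + t ≥ r / 2`.
-/

namespace BuffonNoodle

/-! ### Numbering the squares -/

/-- Apply `e` to each base-`4` digit of `a` and read the result in base `4` again. -/
def mapDigits (e : ℕ → ℕ) (a : ℕ) : ℕ :=
  if h : a = 0 then 0 else e (a % 4) + 4 * mapDigits e (a / 4)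
decreasing_by omega

lemma mapDigits_zero (e : ℕ → ℕ) : mapDigits e 0 = 0 := by
  rw [mapDigits]; simp

lemma mapDigits_eq {e : ℕ → ℕ} (h0 : e 0 = 0) (a : ℕ) :
    mapDigits e a = e (a % 4) + 4 * mapDigits e (a / 4) := by
  rcases eq_or_ne a 0 with rfl | h
  · simp [mapDigits_zero, h0]
  · rw [mapDigits]; simp [h]

lemma mapDigits_split {e : ℕ → ℕ} (h0 : e 0 = 0) (l q b : ℕ) (hb : b < 4 ^ l) :
    mapDigits e (4 ^ l * q + b) = 4 ^ l * mapDigits e q + mapDigits e b := by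
  induction l generalizing b with
  | zero =>
    have : b = 0 := by simpa using hb
    subst this; simp [mapDigits_zero]
  | succ l ih =>
    have h1 : (4 ^ (l + 1) * q + b) % 4 = b % 4 := by
      rw [show 4 ^ (l + 1) * q + b = b + 4 * (4 ^ l * q) by ring, Nat.add_mul_mod_self_left]
    have h2 : (4 ^ (l + 1) * q + b) / 4 = 4 ^ l * q + b / 4 := by
      have : 4 ^ (l + 1) * q + b = b + 4 * (4 ^ l * q) := by ring
      rw [this, Nat.add_mul_div_left _ _ (by norm_num)]; ring
    rw [mapDigits_eq h0, h1, h2, ih (b / 4) (by rw [pow_succ] at hb; omega),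
      mapDigits_eq h0 b]
    ring

lemma mapDigits_digit {e : ℕ → ℕ} (h0 : e 0 = 0) {d : ℕ} (hd : d < 4) :
    mapDigits e d = e d := by
  rw [mapDigits_eq h0, Nat.mod_eq_of_lt hd, Nat.div_eq_of_lt hd, mapDigits_zero]; simp

lemma three_mul_mapDigits_lt {e : ℕ → ℕ} (h0 : e 0 = 0) (h1 : ∀ d < 4, e d ≤ 1) (l b : ℕ)
    (hb : b < 4 ^ l) : 3 * mapDigits e b < 4 ^ l := by
  induction l generalizing b with
  | zero =>
    have : b = 0 := by simpa using hb
    subst this; simp [mapDigits_zero]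
  | succ l ih =>
    rw [mapDigits_eq h0]
    have := ih (b / 4) (by rw [pow_succ] at hb; omega)
    have := h1 (b % 4) (by omega)
    rw [pow_succ]; omega

/-- The squares of `𝒦ₙ` are numbered by `a < 4 ^ n`: the square with lower left corner
`3 · 4⁻ⁿ (x, y)` has the number `a = 2x + y`. This is the integer abscissa `x` of the square number
`a`: the digit `2ε + η` becomes `ε`. -/
def absc (a : ℕ) : ℕ := mapDigits (· / 2) a

/-- The integer ordinate `y` of the square number `a`: the digit `2ε + η` becomes `η`. -/
def ordi (a : ℕ) : ℕ := mapDigits (· % 2) a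

lemma two_mul_absc_add_ordi (a : ℕ) : 2 * absc a + ordi a = a := by
  induction a using Nat.strong_induction_on with
  | _ a ih =>
    rcases eq_or_ne a 0 with rfl | h
    · simp [absc, ordi, mapDigits_zero]
    · have := ih (a / 4) (by omega)
      unfold absc ordi at *
      rw [mapDigits_eq (by simp) a, mapDigits_eq (e := (· % 2)) (by simp) a]
      omega

/-- The cross coordinate `2y - x` of the square number `a`. -/
def cross (a : ℕ) : ℤ := 2 * (ordi a : ℤ) - absc a

/-- Two numbers have a largest scale `4 ^ l` at which they are told apart. -/
lemma exists_level {n a b : ℕ} (ha : a < 4 ^ n) (hb : b < 4 ^ n) (hab : a ≠ b) :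
    ∃ l < n, a / 4 ^ l ≠ b / 4 ^ l ∧ a / 4 ^ (l + 1) = b / 4 ^ (l + 1) := by
  have hex : ∃ m, a / 4 ^ m = b / 4 ^ m :=
    ⟨n, by rw [Nat.div_eq_of_lt ha, Nat.div_eq_of_lt hb]⟩
  classical
  have hpos : Nat.find hex ≠ 0 := by
    intro h
    have := Nat.find_spec hex
    rw [h] at this
    simp at this
    exact hab this
  obtain ⟨l, hl⟩ := Nat.exists_eq_succ_of_ne_zero hpos
  refine ⟨l, ?_, ?_, ?_⟩
  · have : Nat.find hex ≤ n := Nat.find_min' hex (by rw [Nat.div_eq_of_lt ha, Nat.div_eq_of_lt hb])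
    omega
  · exact Nat.find_min hex (by omega)
  · have := Nat.find_spec hex
    rwa [hl] at this

/-- Coordinates of two squares whose numbers lie in the same block of length `4 ^ l` differ by less
than `4 ^ l / 3`. -/
lemma three_mul_mapDigits_sub_lt {e : ℕ → ℕ} (h0 : e 0 = 0) (h1 : ∀ d < 4, e d ≤ 1) {l a b : ℕ}
    (h : a / 4 ^ l = b / 4 ^ l) :
    3 * |(mapDigits e a : ℤ) - mapDigits e b| < 4 ^ l := by
  have hp : 0 < 4 ^ l := by positivity
  have ea := mapDigits_split h0 l (a / 4 ^ l) (a % 4 ^ l) (Nat.mod_lt _ hp)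
  have eb := mapDigits_split h0 l (b / 4 ^ l) (b % 4 ^ l) (Nat.mod_lt _ hp)
  rw [Nat.div_add_mod] at ea eb
  have ba := three_mul_mapDigits_lt h0 h1 l _ (Nat.mod_lt a hp)
  have bb := three_mul_mapDigits_lt h0 h1 l _ (Nat.mod_lt b hp)
  rw [ea, eb, h]
  zify at ba bb
  push_cast
  have : (0:ℤ) ≤ mapDigits e (a % 4 ^ l) := by positivity
  have : (0:ℤ) ≤ mapDigits e (b % 4 ^ l) := by positivity
  rw [show ∀ x y z : ℤ, x + y - (x + z) = y - z from fun x y z => by ring]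
  have h3 : |(mapDigits e (a % 4 ^ l) : ℤ) - mapDigits e (b % 4 ^ l)| * 3
      = |3 * (mapDigits e (a % 4 ^ l) : ℤ) - 3 * mapDigits e (b % 4 ^ l)| := by
    rw [← mul_sub, abs_mul]; simp [mul_comm]
  rw [mul_comm, h3, abs_lt]
  constructor <;> linarith

/-- If the digits number `l` of `a` and `b` have different images, the leading one dominates. -/
lemma two_mul_pow_le_mapDigits_sub {e : ℕ → ℕ} (h0 : e 0 = 0) (h1 : ∀ d < 4, e d ≤ 1) {l a b : ℕ}
    (h : a / 4 ^ (l + 1) = b / 4 ^ (l + 1)) (hd : e (a / 4 ^ l % 4) ≠ e (b / 4 ^ l % 4)) :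
    2 * 4 ^ l ≤ 3 * |(mapDigits e a : ℤ) - mapDigits e b| := by
  have hp : 0 < 4 ^ l := by positivity
  have ea := mapDigits_split h0 l (a / 4 ^ l) (a % 4 ^ l) (Nat.mod_lt _ hp)
  have eb := mapDigits_split h0 l (b / 4 ^ l) (b % 4 ^ l) (Nat.mod_lt _ hp)
  rw [Nat.div_add_mod] at ea eb
  rw [mapDigits_eq h0 (_ / _), Nat.div_div_eq_div_mul, ← pow_succ] at ea eb
  have ba := three_mul_mapDigits_lt h0 h1 l _ (Nat.mod_lt a hp)
  have bb := three_mul_mapDigits_lt h0 h1 l _ (Nat.mod_lt b hp)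
  have da := h1 (a / 4 ^ l % 4) (by omega)
  have db := h1 (b / 4 ^ l % 4) (by omega)
  rw [ea, eb, h]
  zify at ba bb
  generalize e (a / 4 ^ l % 4) = x at *
  generalize e (b / 4 ^ l % 4) = y at *
  have : (0:ℤ) ≤ mapDigits e (a % 4 ^ l) := by positivity
  have : (0:ℤ) ≤ mapDigits e (b % 4 ^ l) := by positivity
  have hxy : (x = 0 ∧ y = 1) ∨ (x = 1 ∧ y = 0) := by omega
  push_cast
  rcases hxy with ⟨rfl, rfl⟩ | ⟨rfl, rfl⟩
  · have := neg_abs_le ((4 ^ l * ((0:ℕ) + 4 * (mapDigits e (b / 4 ^ (l + 1)):ℤ))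
      + (mapDigits e (a % 4 ^ l)) - (4 ^ l * ((1:ℕ) + 4 * (mapDigits e (b / 4 ^ (l + 1)):ℤ))
      + (mapDigits e (b % 4 ^ l)))))
    push_cast at this ⊢
    linarith
  · have := le_abs_self ((4 ^ l * ((1:ℕ) + 4 * (mapDigits e (b / 4 ^ (l + 1)):ℤ))
      + (mapDigits e (a % 4 ^ l)) - (4 ^ l * ((0:ℕ) + 4 * (mapDigits e (b / 4 ^ (l + 1)):ℤ))
      + (mapDigits e (b % 4 ^ l)))))
    push_cast at this ⊢
    linarith

lemma abs_cross_sub_le {l a b : ℕ} (h : a / 4 ^ l = b / 4 ^ l) :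
    |cross a - cross b| ≤ 4 ^ l := by
  have hx := three_mul_mapDigits_sub_lt (e := (· / 2)) (by simp) (by intro d hd; omega) h
  have hy := three_mul_mapDigits_sub_lt (e := (· % 2)) (by simp) (by intro d hd; omega) h
  change 3 * |(absc a : ℤ) - absc b| < _ at hx
  change 3 * |(ordi a : ℤ) - ordi b| < _ at hy
  unfold cross
  have hx1 := le_abs_self ((absc a : ℤ) - absc b)
  have hx2 := neg_abs_le ((absc a : ℤ) - absc b)
  have hy1 := le_abs_self ((ordi a : ℤ) - ordi b)
  have hy2 := neg_abs_le ((ordi a : ℤ) - ordi b)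
  rw [abs_le]
  constructor <;> linarith

/-- Two squares whose numbers lie in a common block of length `4 ^ (l + 1)`, but in different blocks
of length `4 ^ l`, are `4 ^ l` apart up to a constant; if they are close in the direction of
`a = 2x + y`, they are far apart in the orthogonal direction. -/
lemma pow_le_abs_cross_sub {l a b : ℕ} (h : a / 4 ^ (l + 1) = b / 4 ^ (l + 1))
    (hne : a / 4 ^ l ≠ b / 4 ^ l) (hab : |(a : ℤ) - b| ≤ 4 ^ l) :
    4 ^ l ≤ |cross a - cross b| := by
  have hd : a / 4 ^ l % 4 / 2 ≠ b / 4 ^ l % 4 / 2 ∨ a / 4 ^ l % 4 % 2 ≠ b / 4 ^ l % 4 % 2 := by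
    rw [pow_succ, ← Nat.div_div_eq_div_mul, ← Nat.div_div_eq_div_mul] at h
    omega
  have ea := two_mul_absc_add_ordi a
  have eb := two_mul_absc_add_ordi b
  zify at ea eb
  have key : 4 * (4 ^ l) ^ 2 ≤ 9 * (((absc a : ℤ) - absc b) ^ 2 + ((ordi a : ℤ) - ordi b) ^ 2) := by
    rcases hd with hd | hd
    · have := two_mul_pow_le_mapDigits_sub (e := (· / 2)) (by simp)
        (by intro d hd; omega) h hd
      change _ ≤ 3 * |(absc a : ℤ) - absc b| at this
      have h2 := pow_le_pow_left₀ (by positivity) this 2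
      rw [mul_pow, mul_pow, sq_abs] at h2
      nlinarith [sq_nonneg ((ordi a : ℤ) - ordi b)]
    · have := two_mul_pow_le_mapDigits_sub (e := (· % 2)) (by simp)
        (by intro d hd; omega) h hd
      change _ ≤ 3 * |(ordi a : ℤ) - ordi b| at this
      have h2 := pow_le_pow_left₀ (by positivity) this 2
      rw [mul_pow, mul_pow, sq_abs] at h2
      nlinarith [sq_nonneg ((absc a : ℤ) - absc b)]
  have hab2 : ((a : ℤ) - b) ^ 2 ≤ (4 ^ l) ^ 2 := by
    rw [← sq_abs]; exact pow_le_pow_left₀ (abs_nonneg _) hab 2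
  have id : (cross a - cross b) ^ 2 = 5 * (((absc a : ℤ) - absc b) ^ 2 + ((ordi a : ℤ) - ordi b) ^ 2)
      - ((a : ℤ) - b) ^ 2 := by
    rw [← ea, ← eb]; unfold cross; ring
  refine le_of_sq_le_sq ?_ (abs_nonneg _)
  rw [sq_abs]
  nlinarith

/-- The intervals of `𝒞ₙ` have the left endpoints `3 · 4⁻ⁿ x`, where `x` has base-`4` digits `0` and
`1`. -/
lemma mem_cantor {e : ℕ → ℕ} (h0 : e 0 = 0) (h1 : ∀ d < 4, e d ≤ 1) (n a : ℕ) (ha : a < 4 ^ n)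
    {t : ℝ} (ht0 : 0 ≤ t) (ht1 : t ≤ ((4 : ℝ) ^ n)⁻¹) :
    3 * (4 ^ n : ℝ)⁻¹ * mapDigits e a + t ∈ cantor n := by
  induction n generalizing a t with
  | zero =>
    have : a = 0 := by simpa using ha
    subst this
    simp only [mapDigits_zero, cantor]
    simp at ht1 ⊢
    exact ⟨ht0, ht1⟩
  | succ n ih =>
    have hp : 0 < 4 ^ n := by positivity
    have hq : a / 4 ^ n < 4 := by
      rw [Nat.div_lt_iff_lt_mul hp]; rw [pow_succ] at ha; linarith
    have ea := mapDigits_split h0 n (a / 4 ^ n) (a % 4 ^ n) (Nat.mod_lt _ hp)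
    rw [Nat.div_add_mod, mapDigits_digit h0 hq] at ea
    have hm := ih (a % 4 ^ n) (Nat.mod_lt _ hp) (t := 4 * t) (by linarith) (by
      rw [pow_succ, mul_inv] at ht1; linarith)
    have hpr : (0:ℝ) < 4 ^ n := by positivity
    have hd := h1 _ hq
    rw [ea]
    simp only [cantor]
    interval_cases hv : e (a / 4 ^ n)
    · left
      refine ⟨_, hm, ?_⟩
      push_cast
      field_simp
      ring
    · right
      refine ⟨_, hm, ?_⟩
      push_cast
      field_simp
      ring

/-! ### The circular arc and overlaps of two points -/

/-- The circular arc `r - √(r² - y²)`, without the truncation at `|y| = 2`. -/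
noncomputable def cap (r y : ℝ) : ℝ := r - √(r ^ 2 - y ^ 2)

lemma half_le_sqrt {r y : ℝ} (hr : 2 ≤ r) (hy : y ^ 2 ≤ 2) : r / 2 ≤ √(r ^ 2 - y ^ 2) := by
  apply Real.le_sqrt_of_sq_le
  nlinarith

lemma abs_le_of_sq_le_two {y : ℝ} (hy : y ^ 2 ≤ 2) : |y| ≤ 3 / 2 :=
  abs_le_of_sq_le_sq (by norm_num; linarith) (by norm_num)

lemma abs_cap_sub_le {r y z : ℝ} (hr : 2 ≤ r) (hy : y ^ 2 ≤ 2) (hz : z ^ 2 ≤ 2) :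
    |cap r y - cap r z| ≤ 3 / r * |y - z| := by
  have h1 := half_le_sqrt hr hy
  have h2 := half_le_sqrt hr hz
  have e1 := Real.sq_sqrt (show 0 ≤ r ^ 2 - y ^ 2 by nlinarith)
  have e2 := Real.sq_sqrt (show 0 ≤ r ^ 2 - z ^ 2 by nlinarith)
  unfold cap
  set A := √(r ^ 2 - y ^ 2)
  set B := √(r ^ 2 - z ^ 2)
  have hAB : r ≤ A + B := by linarith
  have e : (r - A - (r - B)) * (A + B) = (y + z) * (y - z) := by linarith
  have e' : |r - A - (r - B)| * (A + B) = |y + z| * |y - z| := by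
    rw [← abs_mul, ← e, abs_mul, abs_of_pos (by linarith : 0 < A + B)]
  have h3 : |y + z| ≤ 3 := (abs_add_le y z).trans (by
    linarith [abs_le_of_sq_le_two hy, abs_le_of_sq_le_two hz])
  rw [div_mul_eq_mul_div, le_div_iff₀ (by linarith)]
  have := mul_le_mul_of_nonneg_left hAB (abs_nonneg (r - A - (r - B)))
  have := mul_le_mul_of_nonneg_right h3 (abs_nonneg (y - z))
  linarith

lemma hasDerivAt_cap {r y : ℝ} (hr : 2 ≤ r) (hy : y ^ 2 ≤ 2) :
    HasDerivAt (cap r) (y / √(r ^ 2 - y ^ 2)) y := by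
  have h1 := half_le_sqrt hr hy
  have h : HasDerivAt (fun y : ℝ => r ^ 2 - y ^ 2) (-(2 * y)) y := by
    simpa using ((hasDerivAt_id y).pow 2).const_sub (r ^ 2)
  refine ((h.sqrt (by nlinarith)).const_sub r).congr_deriv ?_
  rw [neg_div, neg_neg, mul_div_mul_left _ _ two_ne_zero]

lemma abs_slope_le {r y : ℝ} (hr : 2 ≤ r) (hy : y ^ 2 ≤ 2) :
    |y / √(r ^ 2 - y ^ 2)| ≤ 3 / r := by
  have h1 := half_le_sqrt hr hy
  have h2 := abs_le_of_sq_le_two hy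
  rw [abs_div, abs_of_nonneg (Real.sqrt_nonneg _), div_le_div_iff₀ (by linarith) (by linarith)]
  nlinarith

lemma abs_slope_sub_le {r y z : ℝ} (hr : 4 ≤ r) (hy : y ^ 2 ≤ 2) (hz : z ^ 2 ≤ 2) :
    |y / √(r ^ 2 - y ^ 2) - z / √(r ^ 2 - z ^ 2)| ≤ 4 / r * |y - z| := by
  have h1 := half_le_sqrt (r := r) (by linarith) hy
  have h2 := half_le_sqrt (r := r) (by linarith) hz
  have h3 := abs_cap_sub_le (by linarith : 2 ≤ r) hy hz
  have h4 := abs_le_of_sq_le_two hz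
  unfold cap at h3
  set A := √(r ^ 2 - y ^ 2)
  set B := √(r ^ 2 - z ^ 2)
  have hA : 0 < A := by linarith
  have hB : 0 < B := by linarith
  have e : y / A - z / B = (y - z) / A + z / A * ((r - A - (r - B)) / B) := by
    field_simp
    ring
  have i1 : |(y - z) / A| ≤ 2 / r * |y - z| := by
    rw [abs_div, abs_of_pos hA, div_le_iff₀ hA]
    have : 2 / r * |y - z| * (r / 2) ≤ 2 / r * |y - z| * A := by gcongr
    have e : 2 / r * |y - z| * (r / 2) = |y - z| := by field_simp
    linarith
  have i2 : |z / A| ≤ 1 := by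
    rw [abs_div, abs_of_pos hA, div_le_one hA]; linarith
  have i3 : |(r - A - (r - B)) / B| ≤ 3 / r * |y - z| / 2 := by
    rw [abs_div, abs_of_pos hB]
    gcongr
    linarith
  rw [e]
  refine (abs_add_le _ _).trans ?_
  rw [abs_mul]
  have := mul_le_mul i2 i3 (abs_nonneg _) zero_le_one
  have e3 : 4 / r * |y - z| = 2 / r * |y - z| + 3 / r * |y - z| / 2 + |y - z| / (2 * r) := by
    field_simp; ring
  have : 0 ≤ |y - z| / (2 * r) := by positivity
  linarith

lemma rotated_sq_le {u v s : ℝ} (h : u ^ 2 + v ^ 2 ≤ 2) :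
    (v * Real.cos s - u * Real.sin s) ^ 2 ≤ 2 := by
  nlinarith [Real.sin_sq_add_cos_sq s, sq_nonneg (v * Real.sin s + u * Real.cos s),
    mul_nonneg (add_nonneg (sq_nonneg u) (sq_nonneg v)) (sq_nonneg (Real.sin s))]

lemma abs_rotated_sub_le (u v u' v' s : ℝ) :
    |(v * Real.cos s - u * Real.sin s) - (v' * Real.cos s - u' * Real.sin s)|
      ≤ |u - u'| + |v - v'| := by
  have : (v * Real.cos s - u * Real.sin s) - (v' * Real.cos s - u' * Real.sin s)
    = (v - v') * Real.cos s - (u - u') * Real.sin s := by ring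
  rw [this]
  refine (abs_sub _ _).trans ?_
  rw [abs_mul, abs_mul]
  have := mul_le_of_le_one_right (abs_nonneg (v - v')) (Real.abs_cos_le_one s)
  have := mul_le_of_le_one_right (abs_nonneg (u - u')) (Real.abs_sin_le_one s)
  linarith

/-- As the direction turns from `s` to `t`, the bending of the noodle changes the relative
position of two points by at most `O(1 / r)` times their distance times the angle. -/
lemma abs_cap_double_sub_le {r u v u' v' : ℝ} (hr : 4 ≤ r) (h : u ^ 2 + v ^ 2 ≤ 2)
    (h' : u' ^ 2 + v' ^ 2 ≤ 2) (s t : ℝ) :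
    |(cap r (v * Real.cos s - u * Real.sin s) - cap r (v' * Real.cos s - u' * Real.sin s)) -
      (cap r (v * Real.cos t - u * Real.sin t) - cap r (v' * Real.cos t - u' * Real.sin t))|
      ≤ 9 / r * (|u - u'| + |v - v'|) * |s - t| := by
  have rot (u v x : ℝ) : HasDerivAt (fun x => v * Real.cos x - u * Real.sin x)
      (-(u * Real.cos x - (-v) * Real.sin x)) x := by
    exact (((Real.hasDerivAt_cos x).const_mul v).sub
      ((Real.hasDerivAt_sin x).const_mul u)).congr_deriv (by ring)
  have der (x : ℝ) := (((hasDerivAt_cap (by linarith : 2 ≤ r)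
    (rotated_sq_le (s := x) h)).comp x (rot u v x)).sub
    ((hasDerivAt_cap (by linarith : 2 ≤ r) (rotated_sq_le (s := x) h')).comp x (rot u' v' x)))
  refine Convex.norm_image_sub_le_of_norm_hasDerivWithin_le (s := Set.univ)
    (fun x _ => (der x).hasDerivWithinAt) (fun x _ => ?_) convex_univ (mem_univ t) (mem_univ s)
  have hs := abs_slope_le (by linarith : 2 ≤ r) (rotated_sq_le (s := x) h)
  have hd := abs_slope_sub_le hr (rotated_sq_le (s := x) h) (rotated_sq_le (s := x) h')
  have hD := abs_rotated_sub_le u v u' v' x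
  have hw : (u' * Real.cos x - (-v') * Real.sin x) ^ 2 ≤ 2 :=
    rotated_sq_le (by linarith [neg_sq v'])
  have hD' := abs_rotated_sub_le (-v) u (-v') u' x
  have habs : |(-v) - (-v')| = |v - v'| := by rw [← abs_neg]; ring_nf
  rw [habs] at hD'
  have hwa := abs_le_of_sq_le_two hw
  set y := v * Real.cos x - u * Real.sin x
  set z := v' * Real.cos x - u' * Real.sin x
  set p := u * Real.cos x - (-v) * Real.sin x
  set q := u' * Real.cos x - (-v') * Real.sin x
  set a := y / √(r ^ 2 - y ^ 2)
  set b := z / √(r ^ 2 - z ^ 2)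
  set D := |u - u'| + |v - v'|
  have hDp : 0 ≤ D := by positivity
  rw [Real.norm_eq_abs, show a * -p - b * -q = -(a * (p - q) + (a - b) * q) by ring, abs_neg]
  refine (abs_add_le _ _).trans ?_
  rw [abs_mul, abs_mul]
  have hr0 : 0 < r := by linarith
  have h1 : |a| * |p - q| ≤ 3 / r * D := by gcongr; linarith
  have h2 : |a - b| * |q| ≤ 4 / r * D * (3 / 2) := by
    gcongr
    exact hd.trans (by gcongr)
  calc _ ≤ 3 / r * D + 4 / r * D * (3 / 2) := add_le_add h1 h2
    _ = _ := by ring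

/-- The position on the line of direction `e^{is}` of the image of `κ (a, V)` under the noodle
shear in that direction. -/
noncomputable def pos (r κ a V s : ℝ) : ℝ :=
  κ * (a * Real.cos s + V * Real.sin s) - cap r (κ * V * Real.cos s - κ * a * Real.sin s)

lemma continuous_pos (r κ a V : ℝ) : Continuous (pos r κ a V) := by
  unfold pos cap; fun_prop

/-- If two points, whose cross coordinates differ by at most `4L`, have overlapping images in a
direction at angle `s ≤ 1 / T`, then their principal coordinates differ by `O(1 + L / T)`. -/
lemma principal_sub_le_of_overlap {r κ a V b W s T L : ℝ} (hT : 1 ≤ T) (hr : 100 * T ≤ r)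
    (hκ : 0 < κ) (ha : (κ * a) ^ 2 + (κ * V) ^ 2 ≤ 2) (hb : (κ * b) ^ 2 + (κ * W) ^ 2 ≤ 2)
    (hs0 : 0 ≤ s) (hs1 : s ≤ 1 / 64) (hsT : s * T ≤ 1) (hVW : |V - W| ≤ 4 * L)
    (hov : |pos r κ a V s - pos r κ b W s| ≤ κ * (3 / 4)) : T * |a - b| ≤ T + 5 * L := by
  have hcos : 0.9 ≤ Real.cos s := by
    have := Real.one_sub_sq_div_two_le_cos (x := s)
    nlinarith
  have hsin : |Real.sin s| ≤ s := by
    have := Real.abs_sin_le_abs (x := s)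
    rwa [abs_of_nonneg hs0] at this
  have hr0 : 0 < r := by linarith
  have hc := abs_cap_sub_le (r := r) (by linarith) (rotated_sq_le (s := s) ha)
    (rotated_sq_le (s := s) hb)
  have hd := abs_rotated_sub_le (κ * a) (κ * V) (κ * b) (κ * W) s
  rw [← mul_sub, ← mul_sub, abs_mul, abs_mul, abs_of_pos hκ] at hd
  unfold pos at hov
  set c := cap r (κ * V * Real.cos s - κ * a * Real.sin s)
  set d := cap r (κ * W * Real.cos s - κ * b * Real.sin s)
  have h3 : 3 / r * T ≤ 0.03 := by
    rw [div_mul_eq_mul_div, div_le_iff₀ hr0]; linarith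
  have hcd : T * |c - d| ≤ 0.03 * (κ * |a - b| + κ * |V - W|) := by
    calc T * |c - d| ≤ T * (3 / r * (κ * |a - b| + κ * |V - W|)) := by
          gcongr; exact hc.trans (by gcongr)
      _ = (3 / r * T) * (κ * |a - b| + κ * |V - W|) := by ring
      _ ≤ _ := by gcongr
  have hmain : κ * |a - b| * Real.cos s ≤ κ * (3 / 4) + κ * |V - W| * s + |c - d| := by
    have e : κ * (a - b) * Real.cos s = (κ * (a * Real.cos s + V * Real.sin s) - c -
      (κ * (b * Real.cos s + W * Real.sin s) - d)) + (-(κ * (V - W) * Real.sin s) + (c - d)) := by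
      ring
    have e2 : κ * |a - b| * Real.cos s = |κ * (a - b) * Real.cos s| := by
      rw [abs_mul, abs_mul, abs_of_pos hκ, abs_of_nonneg (by linarith : 0 ≤ Real.cos s)]
    rw [e2, e]
    refine (abs_add_le _ _).trans ?_
    have h4 := abs_add_le (-(κ * (V - W) * Real.sin s)) (c - d)
    rw [abs_neg, abs_mul, abs_mul, abs_of_pos hκ] at h4
    have : κ * |V - W| * |Real.sin s| ≤ κ * |V - W| * s := by gcongr
    linarith
  have hA : 0 ≤ |a - b| := abs_nonneg _
  have hV : 0 ≤ |V - W| := abs_nonneg _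
  have m1 : κ * |a - b| * 0.9 ≤ κ * |a - b| * Real.cos s := by gcongr
  have m2 : κ * (T * |a - b| * 0.9) ≤
      κ * (T * (3 / 4) + |V - W| * 1 + 0.03 * (|a - b| + |V - W|)) := by
    have := mul_le_mul_of_nonneg_left (m1.trans hmain) (by linarith : 0 ≤ T)
    have h5 : κ * (|V - W| * (s * T)) ≤ κ * (|V - W| * 1) := by gcongr
    nlinarith
  have m3 := le_of_mul_le_mul_left m2 hκ
  nlinarith

/-- Two points which are further apart in the cross direction than in the principal one have
overlapping images only for angles in a set of diameter `O(1 / L)`. -/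
lemma angle_sub_le_of_overlap {r κ a V b W s t L : ℝ} (hr : 100 ≤ r) (hL : 0 < L)
    (hκ : 0 < κ) (ha : (κ * a) ^ 2 + (κ * V) ^ 2 ≤ 2) (hb : (κ * b) ^ 2 + (κ * W) ^ 2 ≤ 2)
    (hs0 : 0 ≤ s) (hs1 : s ≤ 1 / 64) (ht0 : 0 ≤ t) (ht1 : t ≤ 1 / 64)
    (hab : |a - b| ≤ L) (hVW : L ≤ |V - W|)
    (hs : |pos r κ a V s - pos r κ b W s| ≤ κ * (3 / 4))
    (ht : |pos r κ a V t - pos r κ b W t| ≤ κ * (3 / 4)) : |s - t| ≤ 4 / L := by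
  have hr0 : 0 < r := by linarith
  have hdd := abs_cap_double_sub_le (r := r) (by linarith) ha hb s t
  rw [← mul_sub, ← mul_sub, abs_mul, abs_mul, abs_of_pos hκ] at hdd
  have hcos : |Real.cos s - Real.cos t| ≤ 1 / 64 * |s - t| := by
    rw [Real.cos_sub_cos, abs_mul, abs_mul]
    have h1 := Real.abs_sin_le_abs (x := (s + t) / 2)
    have h2 := Real.abs_sin_le_abs (x := (s - t) / 2)
    rw [abs_of_nonneg (by linarith : 0 ≤ (s + t) / 2)] at h1
    have h3 : |(s - t) / 2| = |s - t| / 2 := by rw [abs_div]; norm_num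
    rw [h3] at h2
    have : |(-2 : ℝ)| = 2 := by norm_num
    rw [this]
    calc _ ≤ 2 * (1 / 64) * (|s - t| / 2) := by gcongr; linarith
      _ = _ := by ring
  have hsin : 0.6 * |s - t| ≤ |Real.sin s - Real.sin t| := by
    rw [Real.sin_sub_sin, abs_mul, abs_mul]
    have h3 : |(s - t) / 2| = |s - t| / 2 := by rw [abs_div]; norm_num
    have hst : |s - t| ≤ 1 / 64 := by rw [abs_le]; constructor <;> linarith
    have h4 : 2 / Real.pi * |(s - t) / 2| ≤ |Real.sin ((s - t) / 2)| :=
      Real.mul_abs_le_abs_sin (by rw [h3]; linarith [Real.pi_gt_three])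
    rw [h3] at h4
    have hpi : 0.62 ≤ 2 / Real.pi := by
      rw [le_div_iff₀ Real.pi_pos]; linarith [Real.pi_lt_d2]
    have hc : 0.99 ≤ |Real.cos ((s + t) / 2)| := by
      refine le_trans ?_ (le_abs_self _)
      have := Real.one_sub_sq_div_two_le_cos (x := (s + t) / 2)
      nlinarith
    have h5 : 0.62 * (|s - t| / 2) ≤ |Real.sin ((s - t) / 2)| := le_trans (by gcongr) h4
    have : |(2 : ℝ)| = 2 := by norm_num
    rw [this]
    have := mul_le_mul h5 hc (by norm_num) (abs_nonneg _)
    have : 0 ≤ |s - t| := abs_nonneg _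
    linarith
  unfold pos at hs ht
  set c := cap r (κ * V * Real.cos s - κ * a * Real.sin s)
  set d := cap r (κ * W * Real.cos s - κ * b * Real.sin s)
  set c' := cap r (κ * V * Real.cos t - κ * a * Real.sin t)
  set d' := cap r (κ * W * Real.cos t - κ * b * Real.sin t)
  have e : κ * (V - W) * (Real.sin s - Real.sin t) =
      ((κ * (a * Real.cos s + V * Real.sin s) - c - (κ * (b * Real.cos s + W * Real.sin s) - d))
      - (κ * (a * Real.cos t + V * Real.sin t) - c' - (κ * (b * Real.cos t + W * Real.sin t) - d')))
      + (-(κ * (a - b) * (Real.cos s - Real.cos t)) + ((c - d) - (c' - d'))) := by ring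
  have e1 : |κ * (V - W) * (Real.sin s - Real.sin t)| =
      κ * |V - W| * |Real.sin s - Real.sin t| := by rw [abs_mul, abs_mul, abs_of_pos hκ]
  have e2 : |κ * (a - b) * (Real.cos s - Real.cos t)| =
      κ * |a - b| * |Real.cos s - Real.cos t| := by rw [abs_mul, abs_mul, abs_of_pos hκ]
  have hbound : κ * |V - W| * |Real.sin s - Real.sin t| ≤ κ * (3 / 4) + κ * (3 / 4) +
      (κ * |a - b| * |Real.cos s - Real.cos t| + 9 / r * (κ * |a - b| + κ * |V - W|) * |s - t|) := by
    rw [← e1, e]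
    refine (abs_add_le _ _).trans (add_le_add ((abs_sub _ _).trans (add_le_add hs ht)) ?_)
    refine (abs_add_le _ _).trans (add_le_add ?_ hdd)
    rw [abs_neg, e2]
  have h9 : 9 / r ≤ 0.09 := by rw [div_le_iff₀ hr0]; linarith
  have hst : 0 ≤ |s - t| := abs_nonneg _
  have hA : 0 ≤ |a - b| := abs_nonneg _
  have hV : 0 ≤ |V - W| := abs_nonneg _
  have hAV : |a - b| ≤ |V - W| := hab.trans hVW
  have k1 : κ * |V - W| * (0.6 * |s - t|) ≤ κ * |V - W| * |Real.sin s - Real.sin t| := by gcongr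
  have k2 : κ * |a - b| * |Real.cos s - Real.cos t| ≤ κ * |V - W| * (1 / 64 * |s - t|) := by gcongr
  have k3 : 9 / r * (κ * |a - b| + κ * |V - W|) * |s - t| ≤
      0.09 * (κ * |V - W| + κ * |V - W|) * |s - t| := by gcongr
  have k4 : κ * (|V - W| * |s - t| * 0.375) ≤ κ * 1.5 := by
    have : 0 ≤ κ * |V - W| * |s - t| := by positivity
    linarith
  have k5 := le_of_mul_le_mul_left k4 hκ
  have k6 : L * |s - t| ≤ |V - W| * |s - t| := by gcongr
  rw [le_div_iff₀ hL]
  linarith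

/-! ### Second moments and counting close pairs -/

/-- A quantitative second moment bound: if `𝒰` is a union of intervals of length `δ`, then
`1_𝒰 ≥ 2λF - λ²F²`, where `F` counts the intervals, and this is integrated. -/
lemma volume_iUnion_Icc_ge {ι : Type*} (S : Finset ι) (x : ι → ℝ) {δ : ℝ} (hδ : 0 ≤ δ) (c : ℝ) :
    2 * c * (S.card * δ) - c ^ 2 * (δ * ((S ×ˢ S).filter fun p => |x p.1 - x p.2| ≤ δ).card) ≤
      volume.real (⋃ i ∈ S, Icc (x i) (x i + δ)) := by
  classical
  set U := ⋃ i ∈ S, Icc (x i) (x i + δ) with hU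
  have hUm : MeasurableSet U := Finset.measurableSet_biUnion _ fun _ _ => measurableSet_Icc
  have hUfin : volume U ≠ ⊤ :=
    ((measure_biUnion_finset_le S _).trans_lt
      (ENNReal.sum_lt_top.2 fun i _ => by simp)).ne
  set I : ι → ℝ → ℝ := fun i => (Icc (x i) (x i + δ)).indicator 1 with hI
  have hint (A : Set ℝ) (hA : MeasurableSet A) (hf : volume A ≠ ⊤) :
      Integrable (A.indicator (1 : ℝ → ℝ)) := (integrable_indicator_iff hA).2
        (integrableOn_const (C := (1 : ℝ)) hf)
  have hIint (i : ι) : Integrable (I i) := hint _ measurableSet_Icc (by simp)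
  have hIval (i : ι) : ∫ t, I i t = δ := by
    rw [hI]; simp only
    rw [integral_indicator_one measurableSet_Icc]
    simp [hδ]
  have hII (i j : ι) : (fun t => I i t * I j t) =
      (Icc (x i) (x i + δ) ∩ Icc (x j) (x j + δ)).indicator 1 := by
    ext t
    simp only [hI, Set.inter_indicator_one, Pi.mul_apply]
  have hIIfin (i j : ι) : volume (Icc (x i) (x i + δ) ∩ Icc (x j) (x j + δ)) ≠ ⊤ :=
    ((measure_mono inter_subset_left).trans_lt (by simp)).ne
  have hIIint (i j : ι) : Integrable fun t => I i t * I j t := by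
    rw [hII]; exact hint _ (measurableSet_Icc.inter measurableSet_Icc) (hIIfin i j)
  have hIIval (i j : ι) : ∫ t, I i t * I j t ≤ if |x i - x j| ≤ δ then δ else 0 := by
    rw [hII, integral_indicator_one (measurableSet_Icc.inter measurableSet_Icc)]
    split_ifs with h
    · refine (measureReal_mono inter_subset_left (by simp)).trans ?_
      simp [hδ]
    · have : Icc (x i) (x i + δ) ∩ Icc (x j) (x j + δ) = ∅ := by
        ext t
        simp only [mem_inter_iff, mem_Icc, mem_empty_iff_false, iff_false]
        rintro ⟨⟨_, _⟩, _, _⟩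
        exact h (abs_le.2 ⟨by linarith, by linarith⟩)
      simp [this]
  have hpt (t : ℝ) : 2 * c * ∑ i ∈ S, I i t - c ^ 2 * ∑ p ∈ S ×ˢ S, I p.1 t * I p.2 t ≤
      U.indicator 1 t := by
    rw [Finset.sum_product]
    dsimp only
    rw [← Finset.sum_mul_sum]
    by_cases ht : t ∈ U
    · rw [indicator_of_mem ht]
      simp only [Pi.one_apply]
      nlinarith [sq_nonneg (1 - c * ∑ i ∈ S, I i t)]
    · have : ∀ i ∈ S, I i t = 0 := fun i hi => indicator_of_notMem
        (fun h => ht (mem_iUnion₂.2 ⟨i, hi, h⟩)) _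
      rw [indicator_of_notMem ht, Finset.sum_eq_zero this]
      simp
  have i1 : Integrable fun t => ∑ i ∈ S, I i t := integrable_finsetSum _ fun i _ => hIint i
  have i2 : Integrable fun t => ∑ p ∈ S ×ˢ S, I p.1 t * I p.2 t :=
    integrable_finsetSum _ fun p _ => hIIint p.1 p.2
  have hle := integral_mono ((i1.const_mul (2 * c)).sub (i2.const_mul (c ^ 2)))
    (hint U hUm hUfin) hpt
  rw [integral_indicator_one hUm] at hle
  refine le_trans ?_ hle
  simp only [Pi.sub_apply]
  rw [integral_sub (i1.const_mul (2 * c)) (i2.const_mul (c ^ 2)), integral_const_mul,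
    integral_const_mul, integral_finsetSum _ fun i _ => hIint i,
    integral_finsetSum _ fun p _ => hIIint p.1 p.2]
  simp only [hIval, Finset.sum_const, nsmul_eq_mul]
  refine sub_le_sub_left (mul_le_mul_of_nonneg_left ?_ (sq_nonneg c)) _
  refine (Finset.sum_le_sum fun p _ => hIIval p.1 p.2).trans (le_of_eq ?_)
  rw [← Finset.sum_filter, Finset.sum_const, nsmul_eq_mul, mul_comm]

/-- Pairs of indices at distance at most `M` lying in different blocks of length `L`: such a pair
is close to an end of its block, whence the factor `M ^ 2` in place of `M`. -/
lemma card_close_separated_le (Q L M : ℕ) (hL : 0 < L) (hM : 1 ≤ M) :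
    (((Finset.range (Q * L) ×ˢ Finset.range (Q * L)).filter fun p =>
      p.1 / L ≠ p.2 / L ∧ |(p.1 : ℤ) - p.2| ≤ M).card) ≤ 4 * Q * M ^ 2 := by
  classical
  set S := (Finset.range (Q * L) ×ˢ Finset.range (Q * L)).filter fun p =>
      p.1 / L ≠ p.2 / L ∧ |(p.1 : ℤ) - p.2| ≤ M with hS
  set R := Finset.range Q ×ˢ Finset.range M ×ˢ Finset.range (M + 1) with hR
  have hRc : R.card = Q * (M * (M + 1)) := by simp [hR]
  have key (a b : ℕ) (hb : b < Q * L) (hne : a / L ≠ b / L) (h : |(a : ℤ) - b| ≤ M) (hab : a < b) :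
      b / L < Q ∧ b % L < M ∧ b - a < M + 1 := by
    rw [abs_le] at h
    refine ⟨(Nat.div_lt_iff_lt_mul hL).2 hb, ?_, by omega⟩
    have h1 : a / L < b / L := lt_of_le_of_ne (Nat.div_le_div_right hab.le) hne
    have h2 : a < b / L * L := (Nat.div_lt_iff_lt_mul hL).1 h1
    have h3 := Nat.div_add_mod b L
    rw [mul_comm] at h3
    omega
  have inj (a b a' b' : ℕ) (h : a < b) (h' : a' < b') (e1 : b / L = b' / L) (e2 : b % L = b' % L)
      (e3 : b - a = b' - a') : a = a' ∧ b = b' := by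
    have : b = b' := by rw [← Nat.div_add_mod b L, ← Nat.div_add_mod b' L, e1, e2]
    omega
  have h1 : (S.filter fun p => p.1 < p.2).card ≤ R.card := by
    refine Finset.card_le_card_of_injOn (fun p => (p.2 / L, p.2 % L, p.2 - p.1)) ?_ ?_
    · rintro ⟨a, b⟩ hp
      simp only [hS, Finset.coe_filter, Finset.mem_filter, Finset.mem_product, Finset.mem_range,
        mem_ofPred_eq] at hp
      obtain ⟨⟨⟨_, hb⟩, hne, h⟩, hab⟩ := hp
      simpa [hR, and_assoc] using key a b hb hne h hab
    · rintro ⟨a, b⟩ hp ⟨a', b'⟩ hp' he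
      simp only [Finset.coe_filter, mem_ofPred_eq, Prod.mk.injEq] at hp hp' he ⊢
      exact inj a b a' b' hp.2 hp'.2 he.1 he.2.1 he.2.2
  have h2 : (S.filter fun p => ¬ p.1 < p.2).card ≤ R.card := by
    have hlt (a b : ℕ) (hne : a / L ≠ b / L) (hab : ¬ a < b) : b < a :=
      lt_of_le_of_ne (not_lt.1 hab) fun h => hne (by rw [h])
    refine Finset.card_le_card_of_injOn (fun p => (p.1 / L, p.1 % L, p.1 - p.2)) ?_ ?_
    · rintro ⟨a, b⟩ hp
      simp only [hS, Finset.coe_filter, Finset.mem_filter, Finset.mem_product, Finset.mem_range,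
        mem_ofPred_eq] at hp
      obtain ⟨⟨⟨ha, _⟩, hne, h⟩, hab⟩ := hp
      simpa [hR, and_assoc] using key b a ha hne.symm (by rwa [abs_sub_comm]) (hlt a b hne hab)
    · rintro ⟨a, b⟩ hp ⟨a', b'⟩ hp' he
      simp only [hS, Finset.coe_filter, Finset.mem_filter, mem_ofPred_eq, Prod.mk.injEq]
        at hp hp' he ⊢
      exact (inj b a b' a' (hlt a b hp.1.2.1 hp.2) (hlt a' b' hp'.1.2.1 hp'.2)
        he.1 he.2.1 he.2.2).symm
  rw [← Finset.card_filter_add_card_filter_not (s := S) fun p => p.1 < p.2]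
  have : M * (M + 1) ≤ 2 * M ^ 2 := by nlinarith
  have := Nat.mul_le_mul_left Q this
  rw [hRc] at h1 h2
  linarith

lemma card_close_le (N M : ℕ) :
    (((Finset.range N ×ˢ Finset.range N).filter fun p =>
      |(p.1 : ℤ) - p.2| ≤ M).card) ≤ N * (2 * M + 1) := by
  classical
  refine (Finset.card_le_card_of_injOn (t := Finset.range N ×ˢ Finset.range (2 * M + 1))
    (fun p => (p.1, p.1 + M - p.2)) ?_ ?_).trans (by simp)
  · rintro ⟨a, b⟩ hp
    simp only [Finset.coe_filter, Finset.mem_product, Finset.mem_range, mem_ofPred_eq, abs_le] at hp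
    simp only [Finset.coe_product, Finset.coe_range, mem_prod, mem_Iio]
    omega
  · rintro ⟨a, b⟩ hp ⟨a', b'⟩ hp' he
    simp only [Finset.coe_filter, Finset.mem_product, Finset.mem_range, mem_ofPred_eq, abs_le,
      Prod.mk.injEq] at hp hp' he ⊢
    omega

/-! ### Overlapping directions -/

/-- The scale of the squares of `𝒦ₙ` in the coordinates rotated by `arctan (1 / 2)`. -/
noncomputable def scale (n : ℕ) : ℝ := 3 / (√5 * 4 ^ n)

/-- The position of the lower left corner of the square number `a` of `𝒦ₙ`, in the direction
`arctan (1 / 2) + s`. -/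
noncomputable def cornerPos (n : ℕ) (r : ℝ) (a : ℕ) (s : ℝ) : ℝ := pos r (scale n) a (cross a) s

/-- The union of the intervals of length `4⁻ⁿ` which start at the images of the lower left corners
of the squares of `𝒦ₙ`, in the direction `arctan (1 / 2) + s`. -/
def shadow (n : ℕ) (r s : ℝ) : Set ℝ :=
  ⋃ a ∈ Finset.range (4 ^ n), Icc (cornerPos n r a s) (cornerPos n r a s + (4 ^ n)⁻¹)

lemma continuous_cornerPos (n : ℕ) (r : ℝ) (a : ℕ) : Continuous (cornerPos n r a) :=
  continuous_pos _ _ _ _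

lemma scale_pos (n : ℕ) : 0 < scale n := by unfold scale; positivity

lemma inv_pow_le_scale (n : ℕ) : ((4 : ℝ) ^ n)⁻¹ ≤ scale n * (3 / 4) := by
  have h5 : √5 ≤ 9 / 4 := by rw [Real.sqrt_le_left (by norm_num)]; norm_num
  have h5' : 0 < √5 := by positivity
  unfold scale
  have : 3 / (√5 * 4 ^ n) * (3 / 4) = (9 / 4 / √5) * ((4 : ℝ) ^ n)⁻¹ := by field_simp; norm_num
  rw [this]
  exact le_mul_of_one_le_left (by positivity) ((one_le_div h5').2 h5)

lemma scale_coord_sq_le {n a : ℕ} (ha : a < 4 ^ n) :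
    (scale n * a) ^ 2 + (scale n * cross a) ^ 2 ≤ 2 := by
  have hx := three_mul_mapDigits_lt (e := (· / 2)) (by simp) (by intro d hd; omega) n a ha
  have hy := three_mul_mapDigits_lt (e := (· % 2)) (by simp) (by intro d hd; omega) n a ha
  change 3 * absc a < _ at hx
  change 3 * ordi a < _ at hy
  have ea : (a : ℝ) = 2 * absc a + ordi a := by exact_mod_cast (two_mul_absc_add_ordi a).symm
  have hx' : 3 * (absc a : ℝ) ≤ 4 ^ n := by exact_mod_cast hx.le
  have hy' : 3 * (ordi a : ℝ) ≤ 4 ^ n := by exact_mod_cast hy.le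
  have h5 : √5 ^ 2 = 5 := Real.sq_sqrt (by norm_num)
  unfold scale cross
  push_cast
  rw [ea, mul_pow, mul_pow, div_pow, mul_pow, h5, ← mul_add, div_mul_eq_mul_div,
    div_le_iff₀ (by positivity)]
  have h1 := pow_le_pow_left₀ (by positivity) hx' 2
  have h2 := pow_le_pow_left₀ (by positivity) hy' 2
  nlinarith

/-- The directions in `(4^{-j-1}, 4^{-j}]` for which the intervals of the squares `a` and `b`
overlap. -/
def overlap (n : ℕ) (r : ℝ) (j : ℕ) (p : ℕ × ℕ) : Set ℝ :=
  {s | s ∈ Ioc ((4 : ℝ) ^ (j + 1))⁻¹ ((4 : ℝ) ^ j)⁻¹ ∧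
    |cornerPos n r p.1 s - cornerPos n r p.2 s| ≤ ((4 : ℝ) ^ n)⁻¹}

lemma measurableSet_overlap (n : ℕ) (r : ℝ) (j : ℕ) (p : ℕ × ℕ) :
    MeasurableSet (overlap n r j p) :=
  measurableSet_Ioc.inter (measurableSet_le
    (((continuous_cornerPos n r p.1).sub (continuous_cornerPos n r p.2)).abs.measurable)
    measurable_const)

lemma volume_overlap_le_length (n : ℕ) (r : ℝ) (j : ℕ) (p : ℕ × ℕ) :
    volume.real (overlap n r j p) ≤ ((4 : ℝ) ^ j)⁻¹ := by
  refine (measureReal_mono (fun s hs => hs.1) (by simp)).trans ?_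
  have : (0 : ℝ) < ((4 : ℝ) ^ (j + 1))⁻¹ := by positivity
  rw [Real.volume_real_Ioc]
  exact max_le (by linarith) (by positivity)

/-- Only two kinds of pairs overlap: those with almost equal numbers, and those which separate at
a scale `4 ^ l` with `l ≥ j` and have numbers at distance `O(4 ^ (l - j))`. -/
lemma volume_overlap_le {n : ℕ} {r : ℝ} {j : ℕ} (hj : 3 ≤ j) (hr : 100 * 4 ^ j ≤ r) {p : ℕ × ℕ}
    (ha : p.1 < 4 ^ n) (hb : p.2 < 4 ^ n) :
    volume.real (overlap n r j p) ≤
      (if |(p.1 : ℤ) - p.2| ≤ (2 : ℕ) then ((4 : ℝ) ^ j)⁻¹ else 0) +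
      ∑ l ∈ Finset.Ico j n, if p.1 / 4 ^ l ≠ p.2 / 4 ^ l ∧
        |(p.1 : ℤ) - p.2| ≤ (6 * 4 ^ (l - j) : ℕ) then 8 / (4 : ℝ) ^ l else 0 := by
  obtain ⟨a, b⟩ := p
  simp only at ha hb ⊢
  have hsum0 : 0 ≤ ∑ l ∈ Finset.Ico j n, if a / 4 ^ l ≠ b / 4 ^ l ∧
        |(a : ℤ) - b| ≤ (6 * 4 ^ (l - j) : ℕ) then 8 / (4 : ℝ) ^ l else 0 :=
    Finset.sum_nonneg fun l _ => by split_ifs <;> positivity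
  by_cases h2 : |(a : ℤ) - b| ≤ (2 : ℕ)
  · rw [if_pos h2]
    linarith [volume_overlap_le_length n r j (a, b)]
  rw [if_neg h2, zero_add]
  rcases (overlap n r j (a, b)).eq_empty_or_nonempty with he | ⟨s, hs⟩
  · rw [he]; simpa using hsum0
  have hne : a ≠ b := by rintro rfl; simp at h2
  obtain ⟨l, hln, hsep, hjoin⟩ := exists_level ha hb hne
  have hT : (1 : ℝ) ≤ 4 ^ j := one_le_pow₀ (by norm_num)
  have h64 : (64 : ℝ) ≤ 4 ^ j := by
    calc (64 : ℝ) = 4 ^ 3 := by norm_num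
      _ ≤ 4 ^ j := pow_le_pow_right₀ (by norm_num) hj
  have range_s {s : ℝ} (hs : s ∈ overlap n r j (a, b)) :
      0 ≤ s ∧ s ≤ 1 / 64 ∧ s * 4 ^ j ≤ 1 := by
    obtain ⟨⟨h1, h2⟩, -⟩ := hs
    refine ⟨le_trans (by positivity) h1.le, h2.trans ?_, ?_⟩
    · rw [one_div]; exact inv_anti₀ (by norm_num) h64
    · rwa [← le_div_iff₀ (by positivity), one_div]
  have hov {s : ℝ} (hs : s ∈ overlap n r j (a, b)) :=
    hs.2.trans (inv_pow_le_scale n)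
  have hcross : |(cross a : ℝ) - cross b| ≤ 4 * 4 ^ l := by
    have := abs_cross_sub_le hjoin
    rw [pow_succ, mul_comm] at this
    exact_mod_cast this
  have hprin := principal_sub_le_of_overlap hT hr (scale_pos n) (scale_coord_sq_le ha)
    (scale_coord_sq_le hb) (range_s hs).1 (range_s hs).2.1 (range_s hs).2.2 hcross (hov hs)
  have hprinZ : 4 ^ j * |(a : ℤ) - b| ≤ 4 ^ j + 5 * 4 ^ l := by exact_mod_cast hprin
  have hjl : j ≤ l := by
    by_contra! hlt
    apply h2
    have : (4 : ℤ) ^ (l + 1) ≤ 4 ^ j := pow_le_pow_right₀ (by norm_num) hlt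
    rw [pow_succ] at this
    by_contra! h3
    have h3 : 3 ≤ |(a : ℤ) - b| := by push_cast at h3; omega
    have : (0 : ℤ) < 4 ^ j := by positivity
    nlinarith
  have hsmall : |(a : ℤ) - b| ≤ (6 * 4 ^ (l - j) : ℕ) := by
    have e : (4 : ℤ) ^ l = 4 ^ j * 4 ^ (l - j) := by rw [← pow_add]; congr 1; omega
    have h1 : (1 : ℤ) ≤ 4 ^ (l - j) := one_le_pow₀ (by norm_num)
    rw [e] at hprinZ
    have hp : (0 : ℤ) < 4 ^ j := by positivity
    push_cast
    refine le_of_mul_le_mul_left (hprinZ.trans ?_) hp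
    nlinarith
  have hle : |(a : ℤ) - b| ≤ 4 ^ l := by
    refine hsmall.trans ?_
    have e : (4 : ℤ) ^ l = 4 ^ j * 4 ^ (l - j) := by rw [← pow_add]; congr 1; omega
    have h64' : (64 : ℤ) ≤ 4 ^ j := by exact_mod_cast h64
    push_cast
    rw [e]
    exact mul_le_mul_of_nonneg_right (by linarith) (by positivity)
  have hfar := pow_le_abs_cross_sub hjoin hsep hle
  have hle' : |(a : ℝ) - b| ≤ 4 ^ l := by exact_mod_cast hle
  have hfar' : (4 : ℝ) ^ l ≤ |(cross a : ℝ) - cross b| := by exact_mod_cast hfar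
  have hsub : overlap n r j (a, b) ⊆ Icc (s - 4 / 4 ^ l) (s + 4 / 4 ^ l) := by
    intro t ht
    have := angle_sub_le_of_overlap (by linarith) (by positivity) (scale_pos n)
      (scale_coord_sq_le ha) (scale_coord_sq_le hb) (range_s hs).1 (range_s hs).2.1
      (range_s ht).1 (range_s ht).2.1 hle' hfar' (hov hs) (hov ht)
    rw [abs_le] at this
    constructor <;> linarith
  have hvol : volume.real (overlap n r j (a, b)) ≤ 8 / 4 ^ l := by
    refine (measureReal_mono hsub (by simp)).trans ?_
    rw [Real.volume_real_Icc]
    refine max_le (le_of_eq (by ring)) (by positivity)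
  refine hvol.trans ?_
  refine le_trans ?_ (Finset.single_le_sum (f := fun l => if a / 4 ^ l ≠ b / 4 ^ l ∧
        |(a : ℤ) - b| ≤ (6 * 4 ^ (l - j) : ℕ) then 8 / (4 : ℝ) ^ l else 0)
        (fun l _ => by split_ifs <;> positivity) (Finset.mem_Ico.2 ⟨hjl, hln⟩))
  rw [if_pos ⟨hsep, hsmall⟩]

/-- The total overlap in the `j`-th range of directions. The number of pairs which
separate at the scale `4 ^ l` with close principal
coordinates carries a factor `16⁻ʲ`, since both numbers lie near a common block boundary. -/
lemma sum_volume_overlap_le {n : ℕ} {r : ℝ} {j : ℕ} (hj : 3 ≤ j) (hr : 100 * 4 ^ j ≤ r)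
    (hn : 4 ^ j ≤ n) :
    ((4 : ℝ) ^ n)⁻¹ * ∑ p ∈ Finset.range (4 ^ n) ×ˢ Finset.range (4 ^ n),
      volume.real (overlap n r j p) ≤ 1157 * n / 16 ^ j := by
  set S := Finset.range (4 ^ n) ×ˢ Finset.range (4 ^ n) with hS
  have h1 : ∑ p ∈ S, (if |(p.1 : ℤ) - p.2| ≤ (2 : ℕ) then ((4 : ℝ) ^ j)⁻¹ else 0) ≤
      4 ^ n * (5 / 4 ^ j) := by
    rw [← Finset.sum_filter, Finset.sum_const, nsmul_eq_mul]
    have := card_close_le (4 ^ n) 2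
    have : (((S.filter fun p => |(p.1 : ℤ) - p.2| ≤ (2 : ℕ)).card : ℕ) : ℝ) ≤ 4 ^ n * 5 := by
      exact_mod_cast this
    calc _ ≤ (4 : ℝ) ^ n * 5 * (4 ^ j)⁻¹ := by gcongr
      _ = _ := by ring
  have h2 : ∀ l ∈ Finset.Ico j n, ∑ p ∈ S, (if p.1 / 4 ^ l ≠ p.2 / 4 ^ l ∧
        |(p.1 : ℤ) - p.2| ≤ (6 * 4 ^ (l - j) : ℕ) then 8 / (4 : ℝ) ^ l else 0) ≤
      4 ^ n * (1152 / 16 ^ j) := by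
    intro l hl
    rw [Finset.mem_Ico] at hl
    rw [← Finset.sum_filter, Finset.sum_const, nsmul_eq_mul]
    have e : 4 ^ n = 4 ^ (n - l) * 4 ^ l := by rw [← pow_add]; congr 1; omega
    have := card_close_separated_le (4 ^ (n - l)) (4 ^ l) (6 * 4 ^ (l - j)) (by positivity)
      (by have : 0 < 4 ^ (l - j) := by positivity
          omega)
    rw [← e] at this
    have h3 : (((S.filter fun p => p.1 / 4 ^ l ≠ p.2 / 4 ^ l ∧
        |(p.1 : ℤ) - p.2| ≤ (6 * 4 ^ (l - j) : ℕ)).card : ℕ) : ℝ) ≤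
        4 * 4 ^ (n - l) * (6 * 4 ^ (l - j)) ^ 2 := by exact_mod_cast this
    have e1 : (4 : ℝ) ^ n = 4 ^ (n - l) * 4 ^ l := by exact_mod_cast e
    have e2 : (4 : ℝ) ^ l = 4 ^ (l - j) * 4 ^ j := by rw [← pow_add]; congr 1; omega
    have e3 : (16 : ℝ) ^ j = 4 ^ j * 4 ^ j := by rw [← mul_pow]; norm_num
    calc _ ≤ (4 : ℝ) * 4 ^ (n - l) * (6 * 4 ^ (l - j)) ^ 2 * (8 / 4 ^ l) := by gcongr
      _ = _ := by
        rw [e1, e2, e3]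
        field_simp
        ring
  have h3 : ∑ p ∈ S, volume.real (overlap n r j p) ≤
      4 ^ n * (5 / 4 ^ j) + (n - j : ℕ) * (4 ^ n * (1152 / 16 ^ j)) := by
    refine (Finset.sum_le_sum fun p hp => volume_overlap_le (n := n) hj hr
      (Finset.mem_range.1 (Finset.mem_product.1 hp).1)
      (Finset.mem_range.1 (Finset.mem_product.1 hp).2)).trans ?_
    rw [Finset.sum_add_distrib, Finset.sum_comm]
    refine add_le_add h1 ((Finset.sum_le_sum h2).trans ?_)
    rw [Finset.sum_const, Nat.card_Ico, nsmul_eq_mul]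
  have hnj : ((n - j : ℕ) : ℝ) ≤ n := by exact_mod_cast Nat.sub_le n j
  have hn' : (4 : ℝ) ^ j ≤ n := by exact_mod_cast hn
  have e3 : (16 : ℝ) ^ j = 4 ^ j * 4 ^ j := by rw [← mul_pow]; norm_num
  have h5 : 5 / (4 : ℝ) ^ j ≤ 5 * n / 16 ^ j := by
    rw [e3, div_le_div_iff₀ (by positivity) (by positivity)]
    have := mul_le_mul_of_nonneg_right hn' (by positivity : (0 : ℝ) ≤ 4 ^ j)
    linarith
  calc _ ≤ ((4 : ℝ) ^ n)⁻¹ *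
        (4 ^ n * (5 / 4 ^ j) + (n - j : ℕ) * (4 ^ n * (1152 / 16 ^ j))) := by gcongr
    _ = 5 / 4 ^ j + (n - j : ℕ) * (1152 / 16 ^ j) := by field_simp
    _ ≤ 5 * n / 16 ^ j + n * (1152 / 16 ^ j) := by gcongr
    _ = _ := by ring

/-! ### Integrating over the directions -/

lemma ofReal_integral_le_lintegral_ofReal {α : Type*} [MeasurableSpace α] {μ : Measure α}
    {f : α → ℝ} (hf : Integrable f μ) :
    ENNReal.ofReal (∫ x, f x ∂μ) ≤ ∫⁻ x, ENNReal.ofReal (f x) ∂μ := by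
  rw [integral_eq_lintegral_pos_part_sub_lintegral_neg_part hf]
  exact (ENNReal.ofReal_le_ofReal (sub_le_self _ ENNReal.toReal_nonneg)).trans
    ENNReal.ofReal_toReal_le

/-- Each range of directions `(4^{-j-1}, 4^{-j}]` contributes `≳ 1 / n`. -/
lemma lintegral_shadow_dyadic_ge {n : ℕ} {r : ℝ} {j : ℕ} (hj : 3 ≤ j) (hr : 100 * 4 ^ j ≤ r)
    (hn : 4 ^ j ≤ n) :
    ENNReal.ofReal (1 / (2500 * n)) ≤
      ∫⁻ s in Ioc ((4 : ℝ) ^ (j + 1))⁻¹ ((4 : ℝ) ^ j)⁻¹, volume (shadow n r s) := by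
  set I := Ioc ((4 : ℝ) ^ (j + 1))⁻¹ ((4 : ℝ) ^ j)⁻¹ with hI
  set S := Finset.range (4 ^ n) ×ˢ Finset.range (4 ^ n) with hS
  have hn0 : (0 : ℝ) < n := by
    exact_mod_cast lt_of_lt_of_le (by positivity : 0 < 4 ^ j) hn
  -- the optimal constant in the second moment bound is comparable to `|I| / ∫_I ∫ F²`
  set c : ℝ := 4 ^ j / (2000 * n) with hc
  have hIlen : volume.real I = 3 / 4 * (4 ^ j)⁻¹ := by
    rw [hI, Real.volume_real_Ioc, pow_succ, mul_inv, max_eq_left]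
    · ring
    · have : (0 : ℝ) < (4 ^ j)⁻¹ := by positivity
      linarith
  set g : ℝ → ℝ := fun s =>
    2 * c - c ^ 2 * (((4 : ℝ) ^ n)⁻¹ * ∑ p ∈ S, (overlap n r j p).indicator 1 s) with hg
  have hTint (p : ℕ × ℕ) : IntegrableOn ((overlap n r j p).indicator (1 : ℝ → ℝ)) I := by
    refine (integrable_indicator_iff (measurableSet_overlap n r j p)).2 ?_
    exact integrableOn_const (C := (1 : ℝ)) (by
      refine ((Measure.restrict_apply_le _ _).trans_lt ?_).ne
      exact (measure_mono (fun s hs => hs.1 : overlap n r j p ⊆ I)).trans_lt (by simp))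
  have hsumint : IntegrableOn (fun s => ∑ p ∈ S, (overlap n r j p).indicator (1 : ℝ → ℝ) s) I :=
    integrable_finsetSum _ fun p _ => hTint p
  have hcint : IntegrableOn (fun _ : ℝ => 2 * c) I := integrableOn_const (by simp [hI])
  have hgint : IntegrableOn g I := hcint.sub ((hsumint.const_mul _).const_mul _)
  have hpt : ∀ s ∈ I, ENNReal.ofReal (g s) ≤ volume (shadow n r s) := by
    intro s hs
    have h := volume_iUnion_Icc_ge (Finset.range (4 ^ n)) (fun a => cornerPos n r a s)
      (δ := ((4 : ℝ) ^ n)⁻¹) (by positivity) c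
    refine ENNReal.ofReal_le_of_le_toReal (le_trans (le_of_eq ?_) h)
    rw [hg]
    simp only [Finset.card_range]
    push_cast
    rw [mul_inv_cancel₀ (by positivity), mul_one, ← Finset.sum_boole]
    congr 3
    refine Finset.sum_congr rfl fun p _ => ?_
    by_cases hp : |cornerPos n r p.1 s - cornerPos n r p.2 s| ≤ ((4 : ℝ) ^ n)⁻¹
    · rw [if_pos hp, indicator_of_mem (show s ∈ overlap n r j p from ⟨hs, hp⟩), Pi.one_apply]
    · rw [if_neg hp, indicator_of_notMem fun h => hp h.2]
  have hgval : 1 / (2500 * n) ≤ ∫ s in I, g s := by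
    rw [hg, integral_sub hcint ((hsumint.const_mul _).const_mul _), setIntegral_const,
      integral_const_mul, integral_const_mul, integral_finsetSum _ fun p _ => hTint p]
    have e (p : ℕ × ℕ) : ∫ s in I, (overlap n r j p).indicator (1 : ℝ → ℝ) s =
        volume.real (overlap n r j p) := by
      rw [integral_indicator_one (measurableSet_overlap n r j p), measureReal_restrict_apply
        (measurableSet_overlap n r j p), inter_eq_left.2 fun s hs => hs.1]
    simp only [e]
    rw [hIlen, smul_eq_mul]
    have hsum := sum_volume_overlap_le hj hr hn
    have e3 : (16 : ℝ) ^ j = 4 ^ j * 4 ^ j := by rw [← mul_pow]; norm_num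
    have : c ^ 2 * (((4 : ℝ) ^ n)⁻¹ * ∑ p ∈ S, volume.real (overlap n r j p)) ≤
        c ^ 2 * (1157 * n / 16 ^ j) := by gcongr
    have e4 : c ^ 2 * (1157 * n / 16 ^ j) = 1157 / 4000000 * (1 / n) := by
      rw [hc, e3]; field_simp; norm_num
    have e5 : 3 / 4 * (4 ^ j)⁻¹ * (2 * c) = 3 / 4000 * (1 / n) := by
      rw [hc]; field_simp; norm_num
    have e6 : 1 / (2500 * (n : ℝ)) = 1 / 2500 * (1 / n) := by field_simp
    have : 0 < 1 / (n : ℝ) := by positivity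
    rw [e6]
    linarith
  calc _ ≤ ENNReal.ofReal (∫ s in I, g s) := ENNReal.ofReal_le_ofReal hgval
    _ ≤ ∫⁻ s in I, ENNReal.ofReal (g s) := ofReal_integral_le_lintegral_ofReal hgint
    _ ≤ _ := setLIntegral_mono' measurableSet_Ioc hpt

/-- Summing over the `≈ log n` scales of directions gives the logarithmic gain. -/
lemma lintegral_shadow_ge_of_large {n : ℕ} (hn : 5000 ≤ n) {r : ℝ}
    (hr : (4 : ℝ) ^ ((n : ℝ) / 5) ≤ r) :
    ENNReal.ofReal (1 / 7500 * (Real.log n / n)) ≤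
      ∫⁻ s in Ioc 0 1, volume (shadow n r s) := by
  have hnR : (5000 : ℝ) ≤ n := by exact_mod_cast hn
  have hlog4 : 1 ≤ Real.log 4 := by
    rw [Real.le_log_iff_exp_le (by norm_num)]
    linarith [Real.exp_one_lt_d9]
  have hlog4' : Real.log 4 ≤ 1.4 := by
    have : Real.log 4 = 2 * Real.log 2 := by
      rw [show (4 : ℝ) = 2 ^ 2 by norm_num, Real.log_pow]; norm_num
    linarith [Real.log_two_lt_d9]
  have hrn : 100 * n ≤ r := by
    refine le_trans ?_ hr
    rw [Real.rpow_def_of_pos (by norm_num)]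
    have h1 : (n : ℝ) / 5 ≤ Real.log 4 * (n / 5) := le_mul_of_one_le_left (by positivity) hlog4
    have h2 := Real.quadratic_le_exp_of_nonneg (by positivity : 0 ≤ (n : ℝ) / 5)
    have h3 := Real.exp_le_exp.2 h1
    nlinarith
  set J := Nat.log 4 n with hJ
  have hJ6 : 6 ≤ J := by
    exact Nat.le_log_of_pow_le (by norm_num) (by omega)
  have hJn : 4 ^ J ≤ n := Nat.pow_log_le_self 4 (by omega)
  have hlogn : Real.log n ≤ 1.4 * (J + 1) := by
    have h1 : (n : ℝ) ≤ 4 ^ (J + 1) := by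
      exact_mod_cast (Nat.lt_pow_succ_log_self (by norm_num) n).le
    have h2 := Real.log_le_log (by linarith) h1
    rw [Real.log_pow] at h2
    push_cast at h2
    have : ((J : ℝ) + 1) * Real.log 4 ≤ (J + 1) * 1.4 := by gcongr
    linarith
  have hdisj : ((Finset.Icc 3 J : Finset ℕ) : Set ℕ).PairwiseDisjoint
      (fun j => Ioc ((4 : ℝ) ^ (j + 1))⁻¹ ((4 : ℝ) ^ j)⁻¹) := by
    have aux (i k : ℕ) (h : i < k) : Disjoint (Ioc ((4 : ℝ) ^ (i + 1))⁻¹ ((4 : ℝ) ^ i)⁻¹)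
        (Ioc ((4 : ℝ) ^ (k + 1))⁻¹ ((4 : ℝ) ^ k)⁻¹) := by
      rw [Set.disjoint_left]
      intro x hx hx'
      have : ((4 : ℝ) ^ k)⁻¹ ≤ ((4 : ℝ) ^ (i + 1))⁻¹ :=
        inv_anti₀ (by positivity) (pow_le_pow_right₀ (by norm_num) h)
      linarith [hx.1, hx'.2]
    intro i _ k _ hik
    rcases lt_or_gt_of_ne hik with h | h
    · exact aux i k h
    · exact (aux k i h).symm
  have hsub : (⋃ j ∈ Finset.Icc 3 J, Ioc ((4 : ℝ) ^ (j + 1))⁻¹ ((4 : ℝ) ^ j)⁻¹) ⊆ Ioc 0 1 := by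
    refine iUnion₂_subset fun j _ => Ioc_subset_Ioc (by positivity) ?_
    exact inv_le_one_of_one_le₀ (one_le_pow₀ (by norm_num))
  refine le_trans ?_ (lintegral_mono_set hsub)
  rw [lintegral_biUnion_finset hdisj fun j _ => measurableSet_Ioc]
  have hterm : ∀ j ∈ Finset.Icc 3 J, ENNReal.ofReal (1 / (2500 * n)) ≤
      ∫⁻ s in Ioc ((4 : ℝ) ^ (j + 1))⁻¹ ((4 : ℝ) ^ j)⁻¹, volume (shadow n r s) := by
    intro j hj
    rw [Finset.mem_Icc] at hj
    have hjn : 4 ^ j ≤ n := (Nat.pow_le_pow_right (by norm_num) hj.2).trans hJn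
    refine lintegral_shadow_dyadic_ge hj.1 (le_trans ?_ hrn) hjn
    have : (4 : ℝ) ^ j ≤ n := by exact_mod_cast hjn
    linarith
  refine le_trans ?_ (Finset.sum_le_sum hterm)
  rw [Finset.sum_const, Nat.card_Icc, nsmul_eq_mul, ← ENNReal.ofReal_natCast,
    ← ENNReal.ofReal_mul (by positivity)]
  refine ENNReal.ofReal_le_ofReal ?_
  have hcast : ((J + 1 - 3 : ℕ) : ℝ) = J - 2 := by
    rw [Nat.cast_sub (by omega)]; push_cast; ring
  have hJR : (6 : ℝ) ≤ J := by exact_mod_cast hJ6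
  rw [hcast]
  have : 1 / 7500 * (Real.log n / n) = Real.log n / 3 * (1 / (2500 * n)) := by field_simp; ring
  rw [this]
  gcongr
  linarith

/-- The shadows, integrated over the directions, have size `≳ log n / n`. -/
lemma exists_lintegral_shadow_ge : ∃ c : ℝ, 0 < c ∧ ∀ n : ℕ, 1 ≤ n → ∀ r : ℝ,
    (4 : ℝ) ^ ((n : ℝ) / 5) ≤ r →
    ENNReal.ofReal (c * (Real.log n / n)) ≤ ∫⁻ s in Ioc 0 1, volume (shadow n r s) := by
  have main (N : ℕ) (c : ℝ) (hc : 0 < c) (h : ∀ n : ℕ, N ≤ n → ∀ r : ℝ,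
      (4 : ℝ) ^ ((n : ℝ) / 5) ≤ r →
      ENNReal.ofReal (c * (Real.log n / n)) ≤ ∫⁻ s in Ioc 0 1, volume (shadow n r s)) :
      ∃ c : ℝ, 0 < c ∧ ∀ n : ℕ, 1 ≤ n → ∀ r : ℝ, (4 : ℝ) ^ ((n : ℝ) / 5) ≤ r →
        ENNReal.ofReal (c * (Real.log n / n)) ≤ ∫⁻ s in Ioc 0 1, volume (shadow n r s) := by
    refine ⟨min c ((4 : ℝ) ^ N)⁻¹, lt_min hc (by positivity), fun n hn r hr => ?_⟩
    have hn0 : (0 : ℝ) < n := by exact_mod_cast hn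
    have hlog : 0 ≤ Real.log n := Real.log_nonneg (by exact_mod_cast hn)
    rcases le_or_gt N n with hN | hN
    · refine le_trans (ENNReal.ofReal_le_ofReal ?_) (h n hN r hr)
      exact mul_le_mul_of_nonneg_right (min_le_left _ _) (by positivity)
    -- for small `n`, a single interval is long enough
    have h1 : ∀ s ∈ Ioc (0 : ℝ) 1, ENNReal.ofReal ((4 : ℝ) ^ N)⁻¹ ≤ volume (shadow n r s) := by
      intro s _
      have hsub : Icc (cornerPos n r 0 s) (cornerPos n r 0 s + (4 ^ n)⁻¹) ⊆ shadow n r s :=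
        fun t ht => mem_iUnion₂.2 ⟨0, by simp, ht⟩
      refine le_trans ?_ (measure_mono hsub)
      rw [Real.volume_Icc, add_sub_cancel_left]
      exact ENNReal.ofReal_le_ofReal
        (inv_anti₀ (by positivity) (pow_le_pow_right₀ (by norm_num) hN.le))
    calc ENNReal.ofReal (min c ((4 : ℝ) ^ N)⁻¹ * (Real.log n / n))
        ≤ ENNReal.ofReal ((4 : ℝ) ^ N)⁻¹ := by
          refine ENNReal.ofReal_le_ofReal ?_
          have : Real.log n / n ≤ 1 :=
            (div_le_one hn0).2 ((Real.log_le_sub_one_of_pos hn0).trans (by linarith))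
          calc _ ≤ ((4 : ℝ) ^ N)⁻¹ * 1 := by gcongr; exact min_le_right _ _
            _ = _ := mul_one _
      _ = ∫⁻ _ in Ioc (0 : ℝ) 1, ENNReal.ofReal ((4 : ℝ) ^ N)⁻¹ := by simp
      _ ≤ _ := setLIntegral_mono' measurableSet_Ioc h1
  exact main 5000 (1 / 7500) (by norm_num) fun n hn r hr => lintegral_shadow_ge_of_large hn hr

/-! ### From shadows to images of `𝒦ₙ` -/

/-- The direction `arctan (1 / 2)`, along which the squares of `𝒦ₙ` project onto intervals which
tile an interval. -/
noncomputable def tilingAngle : ℝ := Real.arctan (1 / 2)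

lemma sqrt_one_add_quarter : √(1 + (1 / 2 : ℝ) ^ 2) = √5 / 2 := by
  rw [Real.sqrt_eq_iff_mul_self_eq (by norm_num) (by positivity)]
  have h5 : √5 * √5 = 5 := Real.mul_self_sqrt (by norm_num)
  linarith

lemma cos_tilingAngle : Real.cos tilingAngle = 2 / √5 := by
  rw [tilingAngle, Real.cos_arctan, sqrt_one_add_quarter, one_div_div]

lemma sin_tilingAngle : Real.sin tilingAngle = 1 / √5 := by
  rw [tilingAngle, Real.sin_arctan, sqrt_one_add_quarter]
  field_simp

lemma tilingAngle_pos : 0 < tilingAngle := Real.arctan_pos.2 (by norm_num)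

lemma tilingAngle_add_one_lt : tilingAngle + 1 < Real.pi / 2 := by
  have h : tilingAngle < 1 / 2 := by
    have h1 := Real.arctan_lt_arctan_iff.2
      (Real.lt_tan (x := 1 / 2) (by norm_num) (by linarith [Real.pi_gt_three]))
    rwa [Real.arctan_tan (by linarith [Real.pi_gt_three]) (by linarith [Real.pi_gt_three])] at h1
  linarith [Real.pi_gt_three]

lemma rot_exp_re (θ : ℝ) (z : ℂ) :
    (rot (Circle.exp θ) z).re = z.re * Real.cos θ + z.im * Real.sin θ := by
  simp [rot, Circle.coe_exp, Complex.exp_ofReal_mul_I_re, Complex.exp_ofReal_mul_I_im]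
  ring

lemma rot_exp_im (θ : ℝ) (z : ℂ) :
    (rot (Circle.exp θ) z).im = z.im * Real.cos θ - z.re * Real.sin θ := by
  simp [rot, Circle.coe_exp, Complex.exp_ofReal_mul_I_re, Complex.exp_ofReal_mul_I_im]
  ring

/-- Each point of the shadow is the image of a point of `𝒦ₙ`, found by moving from the corner of a
square in the direction of the projection: this does not change the argument of the noodle. -/
lemma exists_mem_fourCorner_of_mem_shadow {n : ℕ} {r s t : ℝ} (hs : s ∈ Ioc (0 : ℝ) 1)
    (ht : t ∈ shadow n r s) :
    ∃ w ∈ fourCorner n, 0 ≤ (rot (Circle.exp (tilingAngle + s)) w).re ∧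
      (rot (Circle.exp (tilingAngle + s)) w).im ^ 2 ≤ 2 ∧
      (rot (Circle.exp (tilingAngle + s)) w).re -
        cap r (rot (Circle.exp (tilingAngle + s)) w).im = t := by
  obtain ⟨a, ha, hta⟩ := mem_iUnion₂.1 ht
  rw [Finset.mem_range] at ha
  have hθ0 := tilingAngle_pos
  have hθ1 := tilingAngle_add_one_lt
  have hcos : Real.cos (tilingAngle + s) = (2 * Real.cos s - Real.sin s) / √5 := by
    rw [Real.cos_add, cos_tilingAngle, sin_tilingAngle]; ring
  have hsin : Real.sin (tilingAngle + s) = (Real.cos s + 2 * Real.sin s) / √5 := by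
    rw [Real.sin_add, cos_tilingAngle, sin_tilingAngle]; ring
  have hc0 : 0 ≤ Real.cos (tilingAngle + s) :=
    Real.cos_nonneg_of_neg_pi_div_two_le_of_le (by linarith [hs.1, Real.pi_pos]) (by linarith [hs.2])
  have hs0 : 0 ≤ Real.sin (tilingAngle + s) :=
    Real.sin_nonneg_of_nonneg_of_le_pi (by linarith [hs.1]) (by linarith [hs.2, Real.pi_pos])
  have hc1 := Real.cos_le_one (tilingAngle + s)
  have hs1 := Real.sin_le_one (tilingAngle + s)
  have hsc := Real.sin_sq_add_cos_sq (tilingAngle + s)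
  have h5 : √5 ≠ 0 := by positivity
  set τ := t - cornerPos n r a s with hτ
  have hτ0 : 0 ≤ τ := sub_nonneg.2 hta.1
  have hτ1 : τ ≤ ((4 : ℝ) ^ n)⁻¹ := by linarith [hta.2]
  have hea : (a : ℝ) = 2 * absc a + ordi a := by exact_mod_cast (two_mul_absc_add_ordi a).symm
  have hcr : (cross a : ℝ) = 2 * ordi a - absc a := by unfold cross; push_cast; ring
  set x : ℝ := 3 * ((4 : ℝ) ^ n)⁻¹ * absc a with hx
  set y : ℝ := 3 * ((4 : ℝ) ^ n)⁻¹ * ordi a with hy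
  have hx0 : 0 ≤ x := by positivity
  have hy0 : 0 ≤ y := by positivity
  set θ := tilingAngle + s
  have him : (y + τ * Real.sin θ) * Real.cos θ - (x + τ * Real.cos θ) * Real.sin θ =
      scale n * cross a * Real.cos s - scale n * a * Real.sin s := by
    rw [show (y + τ * Real.sin θ) * Real.cos θ - (x + τ * Real.cos θ) * Real.sin θ =
      y * Real.cos θ - x * Real.sin θ by ring, hcos, hsin, hcr, hea, hx, hy, scale]
    field_simp
    ring
  have hre : (x + τ * Real.cos θ) * Real.cos θ + (y + τ * Real.sin θ) * Real.sin θ =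
      scale n * (a * Real.cos s + cross a * Real.sin s) + τ := by
    rw [show (x + τ * Real.cos θ) * Real.cos θ + (y + τ * Real.sin θ) * Real.sin θ =
      x * Real.cos θ + y * Real.sin θ + τ * (Real.sin θ ^ 2 + Real.cos θ ^ 2) by ring, hsc,
      mul_one, hcos, hsin, hcr, hea, hx, hy, scale]
    field_simp
    ring
  refine ⟨⟨x + τ * Real.cos θ, y + τ * Real.sin θ⟩, ⟨?_, ?_⟩, ?_, ?_, ?_⟩
  · exact mem_cantor (e := (· / 2)) (by simp) (by intro d hd; omega) n a ha (by positivity)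
      ((mul_le_of_le_one_right hτ0 hc1).trans hτ1)
  · exact mem_cantor (e := (· % 2)) (by simp) (by intro d hd; omega) n a ha (by positivity)
      ((mul_le_of_le_one_right hτ0 hs1).trans hτ1)
  · rw [rot_exp_re]; positivity
  · rw [rot_exp_im]; simp only
    rw [him]
    exact rotated_sq_le (scale_coord_sq_le ha)
  · rw [rot_exp_re, rot_exp_im]; simp only
    rw [him, hre, hτ, cornerPos, pos]
    ring

/-! ### Favard length -/

lemma arc_eq_cap {r y : ℝ} (hy : y ^ 2 ≤ 2) : arc r y = cap r y := by
  have := abs_le_of_sq_le_two hy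
  rw [arc, if_pos (by linarith), cap]

lemma proj_sigma (g : ℝ → ℝ) (u : Circle) (z : ℂ) :
    proj u (sigma g (z, u)) = (rot u z).re - g (rot u z).im := by
  have (w : ℂ) : rot u (rot u⁻¹ w) = w := by
    unfold rot
    rw [← mul_assoc, ← map_mul, ← Circle.coe_mul, mul_inv_cancel]
    simp
  simp only [proj, sigma, this, shear]

lemma shadow_subset_proj {n : ℕ} {r s : ℝ} (hs : s ∈ Ioc (0 : ℝ) 1) :
    shadow n r s ⊆ proj (Circle.exp (tilingAngle + s)) ''
      ((fun z : ℂ => sigma (arc r) (z, Circle.exp (tilingAngle + s))) '' fourCorner n) := by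
  intro t ht
  obtain ⟨w, hw, -, him, h⟩ := exists_mem_fourCorner_of_mem_shadow hs ht
  refine ⟨_, ⟨w, hw, rfl⟩, ?_⟩
  simp only
  rw [proj_sigma, arc_eq_cap him, h]

lemma lintegral_shadow_le_favardLength (n : ℕ) (r : ℝ) :
    (ENNReal.ofReal (2 * Real.pi))⁻¹ * ∫⁻ s in Ioc 0 1, volume (shadow n r s) ≤
      favardLength (sigma (arc r)) (fourCorner n) := by
  unfold favardLength
  refine mul_le_mul_right ?_ _
  set G : ℝ → ℝ≥0∞ := fun θ => volume (proj (Circle.exp θ) ''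
    ((fun z : ℂ => sigma (arc r) (z, Circle.exp θ)) '' fourCorner n))
  have hpre : (fun s => tilingAngle + s) ⁻¹' Ioc tilingAngle (tilingAngle + 1) = Ioc 0 1 := by
    simp
  calc ∫⁻ s in Ioc 0 1, volume (shadow n r s)
      ≤ ∫⁻ s in Ioc (0 : ℝ) 1, G (tilingAngle + s) :=
        setLIntegral_mono' measurableSet_Ioc fun s hs => measure_mono (shadow_subset_proj hs)
    _ = ∫⁻ θ in Ioc tilingAngle (tilingAngle + 1), G θ := by
        rw [← hpre]
        exact (measurePreserving_add_left volume tilingAngle).setLIntegral_comp_preimage_emb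
          (measurableEmbedding_addLeft tilingAngle) G _
    _ ≤ ∫⁻ θ in Ioc 0 (2 * Real.pi), G θ :=
        lintegral_mono_set (Ioc_subset_Ioc tilingAngle_pos.le
          (by linarith [tilingAngle_add_one_lt, Real.pi_pos]))

/-! ### Centers of circles -/

/-- In polar coordinates, the centers of the circles which meet `𝒦ₙ` contain the shadows shifted
by the radius. -/
lemma polarCoord_symm_mem_centers {n : ℕ} {r s t : ℝ} (hr : 2 ≤ r ^ 2 * (3 / 4)) (hr0 : 0 < r)
    (hs : s ∈ Ioc (0 : ℝ) 1) (ht : t ∈ shadow n r s) :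
    r / 2 ≤ r + t ∧ Complex.polarCoord.symm (r + t, tilingAngle + s) ∈ centers n r := by
  obtain ⟨w, hw, hre, him, h⟩ := exists_mem_fourCorner_of_mem_shadow hs ht
  have hsq := Real.sq_sqrt (show 0 ≤ r ^ 2 - (rot (Circle.exp (tilingAngle + s)) w).im ^ 2 by
    nlinarith)
  have hhalf : r / 2 ≤ √(r ^ 2 - (rot (Circle.exp (tilingAngle + s)) w).im ^ 2) :=
    Real.le_sqrt_of_sq_le (by linarith)
  unfold cap at h
  refine ⟨by linarith, w, ?_, hw⟩
  rw [mem_sphere_iff_norm, ← sq_eq_sq₀ (norm_nonneg _) hr0.le, Complex.sq_norm,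
    Complex.normSq_apply, Complex.polarCoord_symm_apply]
  set θ := tilingAngle + s
  rw [rot_exp_re, rot_exp_im] at h
  rw [rot_exp_im] at hsq
  set D := √(r ^ 2 - (w.im * Real.cos θ - w.re * Real.sin θ) ^ 2)
  set P := w.re * Real.cos θ + w.im * Real.sin θ with hP
  have ht' : r + t = P + D := by linarith
  simp only [ht', Complex.sub_re, Complex.sub_im, Complex.mul_re, Complex.mul_im,
    Complex.ofReal_re, Complex.ofReal_im, Complex.add_re, Complex.add_im, Complex.I_re,
    Complex.I_im]
  linear_combination ((P + D) ^ 2 - w.re ^ 2 - w.im ^ 2) * Real.sin_sq_add_cos_sq θ + hsq +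
    (P + w.re * Real.cos θ + w.im * Real.sin θ - 2 * (P + D)) * hP

lemma lintegral_shadow_le_volume_centers {n : ℕ} {r : ℝ} (hr : 2 ≤ r ^ 2 * (3 / 4)) (hr0 : 0 < r) :
    ENNReal.ofReal (r / 2) * ∫⁻ s in Ioc 0 1, volume (shadow n r s) ≤ volume (centers n r) := by
  set B : Set (ℝ × ℝ) := {p | p.2 ∈ Ioc 0 1 ∧ p.1 ∈ shadow n r p.2} with hB
  have hBm : MeasurableSet B := by
    refine (measurable_snd measurableSet_Ioc).inter ?_
    have : {p : ℝ × ℝ | p.1 ∈ shadow n r p.2} = ⋃ a ∈ Finset.range (4 ^ n),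
        {p : ℝ × ℝ | cornerPos n r a p.2 ≤ p.1 ∧ p.1 ≤ cornerPos n r a p.2 + (4 ^ n)⁻¹} := by
      ext p; simp [shadow]
    change MeasurableSet {p : ℝ × ℝ | p.1 ∈ shadow n r p.2}
    rw [this]
    refine Finset.measurableSet_biUnion _ fun a _ => ?_
    have hcont : Continuous fun p : ℝ × ℝ => cornerPos n r a p.2 :=
      (continuous_cornerPos n r a).comp continuous_snd
    exact (measurableSet_le hcont.measurable measurable_fst).inter
      (measurableSet_le measurable_fst (hcont.measurable.add_const _))
  have hBvol : ∫⁻ s in Ioc 0 1, volume (shadow n r s) = volume B := by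
    rw [Measure.volume_eq_prod, Measure.prod_apply_symm hBm, ← lintegral_indicator measurableSet_Ioc]
    refine lintegral_congr fun s => ?_
    by_cases hs : s ∈ Ioc (0 : ℝ) 1
    · rw [indicator_of_mem hs]
      congr 1
      ext t
      exact ⟨fun h => ⟨hs, h⟩, fun h => h.2⟩
    · rw [indicator_of_notMem hs]
      have : (fun x => (x, s)) ⁻¹' B = ∅ := by
        ext t
        exact ⟨fun h => hs h.1, fun h => h.elim⟩
      rw [this, measure_empty]
  set A : Set (ℝ × ℝ) := Prod.map (fun ρ => ρ - r) (fun θ => θ - tilingAngle) ⁻¹' B with hA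
  have hmp : MeasurePreserving (Prod.map (fun ρ : ℝ => ρ - r) (fun θ : ℝ => θ - tilingAngle)) :=
    (measurePreserving_sub_right volume r).prod (measurePreserving_sub_right volume tilingAngle)
  have hAm : MeasurableSet A := hmp.measurable hBm
  have hAvol : volume A = volume B := hmp.measure_preimage hBm.nullMeasurableSet
  have hAmem : ∀ p ∈ A, r / 2 ≤ p.1 ∧ Complex.polarCoord.symm p ∈ centers n r := by
    rintro ⟨ρ, θ⟩ ⟨hs, ht⟩
    have := polarCoord_symm_mem_centers hr hr0 hs ht
    simpa using this
  have hAtarget : A ⊆ polarCoord.target := by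
    rintro ⟨ρ, θ⟩ hp
    have h1 := (hAmem _ hp).1
    have h2 := hp.1
    simp only [Prod.map, mem_Ioc] at h1 h2
    rw [polarCoord_target]
    refine ⟨mem_Ioi.2 (by linarith), ?_, ?_⟩
    · linarith [tilingAngle_pos, Real.pi_pos, h2.1]
    · change θ < Real.pi
      linarith [tilingAngle_add_one_lt, Real.pi_pos, h2.2]
  rw [hBvol, ← hAvol]
  calc ENNReal.ofReal (r / 2) * volume A
      = ∫⁻ _ in A, ENNReal.ofReal (r / 2) := by rw [setLIntegral_const]
    _ ≤ ∫⁻ p in A, ENNReal.ofReal p.1 •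
          (centers n r).indicator 1 (Complex.polarCoord.symm p) := by
        refine setLIntegral_mono' hAm fun p hp => ?_
        rw [indicator_of_mem (hAmem p hp).2, Pi.one_apply, smul_eq_mul, mul_one]
        exact ENNReal.ofReal_le_ofReal (hAmem p hp).1
    _ ≤ ∫⁻ p in polarCoord.target, ENNReal.ofReal p.1 •
          (centers n r).indicator 1 (Complex.polarCoord.symm p) := lintegral_mono_set hAtarget
    _ = ∫⁻ z, (centers n r).indicator 1 z := Complex.lintegral_comp_polarCoord_symm _
    _ ≤ volume (centers n r) := lintegral_indicator_one_le _

end BuffonNoodle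

theorem theorem2 :
    ∃ C : ℝ, 0 < C ∧
      ∀ r : ℕ → ℝ, (∀ n : ℕ, 1 ≤ n → (4 : ℝ) ^ ((n : ℝ) / 5) ≤ r n) →
        BuffonNoodle.IsUndercooked C r ∧
        ∀ n : ℕ, 1 ≤ n →
          ENNReal.ofReal (C * (r n * (Real.log n / n))) ≤
            volume (BuffonNoodle.centers n (r n)) := by
  obtain ⟨c, hc, h⟩ := BuffonNoodle.exists_lintegral_shadow_ge
  have hpi := Real.pi_pos
  refine ⟨c / (2 * Real.pi), by positivity, fun r hr => ⟨fun n hn => ?_, fun n hn => ?_⟩⟩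
  · refine le_trans ?_ (BuffonNoodle.lintegral_shadow_le_favardLength n (r n))
    refine le_trans (le_of_eq ?_) (mul_le_mul_right (h n hn (r n) (hr n hn)) _)
    rw [← ENNReal.ofReal_inv_of_pos (by positivity), ← ENNReal.ofReal_mul (by positivity)]
    congr 1
    ring
  · rcases hn.eq_or_lt with rfl | hn2
    · simp
    have hr0 : 0 < r n := lt_of_lt_of_le (by positivity) (hr n hn)
    have hr2 : 2 ≤ r n ^ 2 * (3 / 4) := by
      have hn2' : (2 : ℝ) ≤ n := by exact_mod_cast hn2
      have h1 : (4 : ℝ) ^ ((3 : ℝ) / 8) ≤ r n :=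
        (Real.rpow_le_rpow_of_exponent_le (by norm_num) (by linarith)).trans (hr n hn)
      -- `r ≥ 4 ^ (2 / 5) ≥ 4 ^ (3 / 8)`, and the eighth power of the latter is `64 > (8 / 3) ^ 4`
      have h2 : ((4 : ℝ) ^ ((3 : ℝ) / 8)) ^ 8 = 64 := by
        rw [← Real.rpow_natCast, ← Real.rpow_mul (by norm_num)]
        norm_num
      have h3 : (64 : ℝ) ≤ r n ^ 8 := h2 ▸ pow_le_pow_left₀ (by positivity) h1 8
      by_contra! hlt
      have h4 : (r n ^ 2) ^ 4 ≤ (8 / 3) ^ 4 := pow_le_pow_left₀ (by positivity) (by linarith) 4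
      rw [← pow_mul] at h4
      norm_num at h4
      linarith
    refine le_trans ?_ (BuffonNoodle.lintegral_shadow_le_volume_centers hr2 hr0)
    refine le_trans ?_ (mul_le_mul_right (h n hn (r n) (hr n hn)) _)
    rw [← ENNReal.ofReal_mul (by positivity)]
    refine ENNReal.ofReal_le_ofReal ?_
    have hlog : 0 ≤ Real.log n := Real.log_nonneg (by exact_mod_cast hn)
    have h1 : c / (2 * Real.pi) ≤ c / 2 :=
      div_le_div_of_nonneg_left hc.le (by norm_num) (by linarith [Real.pi_gt_three])
    calc _ ≤ c / 2 * (r n * (Real.log n / n)) := by gcongr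
      _ = _ := by ring
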